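/- Let $d \ge 1$, let $p=(p_1,\dots,p_d)$ be a vector of positive integers, and let $V:\mathbb{Z}^d\to\mathbb{R}$ be $p$-periodic, i.e. $V(n+m)=V(n)$ for all $n\in\mathbb{Z}^d$ and $m\in p_1\mathbb{Z}\oplus\cdots\oplus p_d\mathbb{Z}$. Suppose that $V$ is non-degenerate, i.e. injective on the fundamental cell $W=\prod_{i=1}^d\{0,1,\dots,p_i-1\}$. Put $p_0=\min\{p_1,\dots,p_d\}$ and, for $\mu\in\mathbb{R}$, let $H_\mu=\Delta+\mu V$ on $\ell^2(\mathbb{Z}^d)$, that is, $$[H_\mu\psi](n)=\mu V(n)\psi(n)+\sum_{|m-n|_1=1}\psi(m).$$ Let $X\psi=(X_1\psi,\dots,X_d\psi)$, $[X_i\psi](n)=n_i\psi(n)$, be the position operator, with domain $D(X)=\{\psi\in\ell^2(\mathbb{Z}^d): X_i\psi\in\ell^2(\mathbb{Z}^d)\text{ for all } i\}$ and values in $\ell^2(\mathbb{Z}^d)^d$, and define $$v_{\mathrm{asy}}(H,\psi)=\limsup_{t\to\infty}\frac1t\big\|Xe^{-\mathrm{i}tH}\psi\big\|,\qquad v_{\mathrm{asy}}(H)=\sup_{\psi\in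 D(X),\ \|\psi\|=1}v_{\mathrm{asy}}(H,\psi).$$ Then there is a constant $C>0$, depending on $V$ and $p$, such that, as $\mu\to\infty$, $$v_{\mathrm{asy}}(H_\mu)=C\mu^{-p_0+1}+O(\mu^{-p_0}).$$ Moreover, there is a constant $c>0$, depending on $V$ and $p$, such that, as $\mu\to\infty$, $$v_{\mathrm{asy}}(H_\mu,\delta_0)=c\mu^{-p_0+1}+O(\mu^{-p_0}),$$ where $\delta_0$ is the unit vector supported at the origin. -/

import Mathlib

open Filter Asymptotics
open scoped ENNReal

noncomputable section

namespace PeriodicSchrodinger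

/-- The lattice `ℤ^d`. -/
abbrev Lat (d : ℕ) : Type := Fin d → ℤ

/-- The Hilbert space `ℓ²(ℤ^d)` of square-summable complex-valued functions on `ℤ^d`. -/
abbrev Hilb (d : ℕ) : Type := lp (fun _ : Lat d => ℂ) 2

/-- `V` is `p`-periodic: `V (n + m) = V n` for all `n ∈ ℤ^d` and all
`m = (x₁ p₁, …, x_d p_d)` in the period lattice `p₁ ℤ ⊕ ⋯ ⊕ p_d ℤ`. -/
def IsPeriodic {d : ℕ} (p : Fin d → ℕ) (V : Lat d → ℝ) : Prop :=
  ∀ n x : Lat d, V (n + fun i => x i * (p i : ℤ)) = V n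

/-- The fundamental cell `W = [p₁] × ⋯ × [p_d]`, where `[ℓ] = {0, …, ℓ - 1}`. -/
def cell {d : ℕ} (p : Fin d → ℕ) : Set (Lat d) :=
  {n | ∀ i, 0 ≤ n i ∧ n i < (p i : ℤ)}

/-- `V` is non-degenerate: it is injective on the fundamental cell. -/
def IsNondegenerate {d : ℕ} (p : Fin d → ℕ) (V : Lat d → ℝ) : Prop :=
  Set.InjOn V (cell p)

/-- A periodic function on `ℤ^d` is bounded. -/
theorem IsPeriodic.exists_bound {d : ℕ} {p : Fin d → ℕ} (hp : ∀ i, 0 < p i) {V : Lat d → ℝ}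
    (hV : IsPeriodic p V) : ∃ C : ℝ, ∀ n, |V n| ≤ C := by
  have hfin : (cell p).Finite := by
    refine (Set.Finite.pi' (fun i => Set.finite_Ico (0 : ℤ) (p i : ℤ))).subset ?_
    intro n hn i
    exact ⟨(hn i).1, (hn i).2⟩
  obtain ⟨C, hC⟩ := (hfin.image fun n => |V n|).bddAbove
  refine ⟨C, fun n => ?_⟩
  have hmem : (fun i => n i % (p i : ℤ)) ∈ cell p := fun i =>
    ⟨Int.emod_nonneg _ (by have := hp i; omega), Int.emod_lt_of_pos _ (by exact_mod_cast hp i)⟩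
  have h := hV (fun i => n i % (p i : ℤ)) (fun i => n i / (p i : ℤ))
  have hn : ((fun i => n i % (p i : ℤ)) + fun i => n i / (p i : ℤ) * (p i : ℤ)) = n := by
    funext i
    simpa [mul_comm] using Int.emod_add_mul_ediv (n i) (p i : ℤ)
  rw [hn] at h
  rw [h]
  exact hC ⟨_, hmem, rfl⟩

/-- The translation `(T_e ψ)(n) = ψ (n + e)` as a bounded operator on `ℓ²(ℤ^d)`. -/
def translation {d : ℕ} (e : Lat d) : Hilb d →L[ℂ] Hilb d :=
  LinearMap.mkContinuous
    { toFun := fun ψ => ⟨fun n => ψ (n + e), memℓp_gen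
        (((lp.memℓp ψ).summable (by norm_num)).comp_injective (add_left_injective e))⟩
      map_add' := fun _ _ => rfl
      map_smul' := fun _ _ => rfl } 1 (fun ψ => by
        refine lp.norm_le_of_tsum_le (by norm_num) (by positivity) ?_
        rw [one_mul, lp.norm_rpow_eq_tsum (by norm_num) ψ]
        exact ((Equiv.addRight e).tsum_eq fun n => ‖ψ n‖ ^ (2 : ℝ≥0∞).toReal).le)

/-- Multiplication `ψ ↦ V ψ` by a bounded real function, as a bounded operator on `ℓ²(ℤ^d)`. -/
def potential {d : ℕ} (V : Lat d → ℝ) (hV : ∃ C : ℝ, ∀ n, |V n| ≤ C) : Hilb d →L[ℂ] Hilb d :=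
  LinearMap.mkContinuousOfExistsBound
    { toFun := fun ψ => ⟨fun n => (V n : ℂ) * ψ n, by
        obtain ⟨C, hC⟩ := hV
        refine Memℓp.mono (g := fun n => C * ‖ψ n‖)
          ((memℓp_norm_iff.mpr (lp.memℓp ψ)).const_mul C) fun n => ?_
        rw [norm_mul, Complex.norm_real]
        exact mul_le_mul_of_nonneg_right (hC n) (norm_nonneg _)⟩
      map_add' := fun ψ φ => by
        ext n
        exact mul_add _ _ _
      map_smul' := fun c ψ => by
        ext n
        exact mul_left_comm _ _ _ } (by
    obtain ⟨C, hC⟩ := hV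
    have hC0 : 0 ≤ C := (abs_nonneg _).trans (hC 0)
    refine ⟨C, fun ψ => lp.norm_le_of_tsum_le (by norm_num) (by positivity) ?_⟩
    have hs := (lp.memℓp ψ).summable (by norm_num)
    rw [Real.mul_rpow hC0 (norm_nonneg _), lp.norm_rpow_eq_tsum (by norm_num) ψ, ← tsum_mul_left]
    have hle : ∀ n, ‖(V n : ℂ) * ψ n‖ ^ (2 : ℝ≥0∞).toReal
        ≤ C ^ (2 : ℝ≥0∞).toReal * ‖ψ n‖ ^ (2 : ℝ≥0∞).toReal := fun n => by
      rw [← Real.mul_rpow hC0 (norm_nonneg _), norm_mul, Complex.norm_real]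
      exact Real.rpow_le_rpow (by positivity)
        (mul_le_mul_of_nonneg_right (hC n) (norm_nonneg _)) (by norm_num)
    exact Summable.tsum_le_tsum hle
      (Summable.of_nonneg_of_le (fun n => by positivity) hle (hs.mul_left _)) (hs.mul_left _))

/-- The operator `Δ` on `ℓ²(ℤ^d)`: `(Δψ)(n)` is the sum of `ψ` over the `2d` nearest
neighbours `n ± e_i` of `n`, i.e. over the points `m` with `|n - m|₁ = 1`. -/
def laplacian (d : ℕ) : Hilb d →L[ℂ] Hilb d :=
  ∑ i : Fin d, (translation (Pi.single i 1) + translation (-Pi.single i 1))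

/-- The Schrödinger operator `H_μ = Δ + μ V` on `ℓ²(ℤ^d)`, for a bounded potential `V`. -/
def hamiltonian {d : ℕ} (V : Lat d → ℝ) (hV : ∃ C : ℝ, ∀ n, |V n| ≤ C) (μ : ℝ) :
    Hilb d →L[ℂ] Hilb d :=
  laplacian d + (μ : ℂ) • potential V hV

theorem hamiltonian_apply {d : ℕ} (V : Lat d → ℝ) (hV : ∃ C : ℝ, ∀ n, |V n| ≤ C) (μ : ℝ)
    (ψ : Hilb d) (n : Lat d) :
    hamiltonian V hV μ ψ n
      = ∑ i : Fin d, (ψ (n + Pi.single i 1) + ψ (n - Pi.single i 1)) + (μ * V n : ℝ) * ψ n := by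
  have h1 : hamiltonian V hV μ ψ = ∑ i : Fin d, (translation (Pi.single i 1) ψ
      + translation (-Pi.single i 1) ψ) + (μ : ℂ) • potential V hV ψ := by
    simp only [hamiltonian, laplacian, add_apply, sum_apply]
    rfl
  have h2 : ((μ : ℂ) • potential V hV ψ : Hilb d) n = (μ * V n : ℝ) * ψ n := by
    push_cast
    rw [mul_assoc]
    rfl
  rw [h1, lp.coeFn_add, Pi.add_apply, h2, lp.coeFn_sum, Finset.sum_apply]
  simp only [sub_eq_add_neg]
  rfl

/-- The unitary group `e^{-itH}` generated by a bounded self-adjoint operator `H`. -/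
def evolution {d : ℕ} (H : Hilb d →L[ℂ] Hilb d) (t : ℝ) : Hilb d →L[ℂ] Hilb d :=
  NormedSpace.exp ((-(Complex.I * (t : ℂ))) • H)

/-- The domain `D(X)` of the position operator `Xψ = (X₁ψ, …, X_dψ)`, `(X_i ψ)(n) = n_i ψ(n)`:
all `ψ ∈ ℓ²(ℤ^d)` such that every `X_i ψ` lies in `ℓ²(ℤ^d)`. -/
def positionDomain (d : ℕ) : Set (Hilb d) :=
  {ψ | ∀ i, Memℓp (fun n : Lat d => ((n i : ℤ) : ℂ) * ψ n) 2}

/-- The norm `‖Xψ‖` in `ℓ²(ℤ^d)^d`, that is `(∑_i ‖X_i ψ‖²)^{1/2}`, as an extended number;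
it is `∞` exactly when `ψ` is not in `D(X)`. -/
def positionNorm {d : ℕ} (ψ : Hilb d) : ℝ≥0∞ :=
  (∑ i : Fin d, ∑' n : Lat d, ‖((n i : ℤ) : ℂ) * ψ n‖ₑ ^ 2) ^ (1 / 2 : ℝ)

/-- The asymptotic velocity of the state `ψ`:
`v_asy(H, ψ) = limsup_{t → ∞} (1/t) ‖X e^{-itH} ψ‖`. -/
def asympVelocityAt {d : ℕ} (H : Hilb d →L[ℂ] Hilb d) (ψ : Hilb d) : ℝ≥0∞ :=
  limsup (fun t : ℝ => positionNorm (evolution H t ψ) / ENNReal.ofReal t) atTop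

/-- The asymptotic velocity of `H`: the supremum of `v_asy(H, ψ)` over the normalized
states `ψ ∈ D(X)`. -/
def asympVelocity {d : ℕ} (H : Hilb d →L[ℂ] Hilb d) : ℝ≥0∞ :=
  ⨆ ψ ∈ {ψ : Hilb d | ψ ∈ positionDomain d ∧ ‖ψ‖ = 1}, asympVelocityAt H ψ

/-- The unit vector `δ₀` supported at the origin. -/
def deltaZero (d : ℕ) : Hilb d := lp.single 2 0 1

/-- The extended nonnegative numbers `v μ` satisfy, as `μ → ∞`,
`v μ = C μ ^ (-q + 1) + O(μ ^ (-q))`; in particular they are eventually finite. -/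
def HasVelocityAsymptotics (v : ℝ → ℝ≥0∞) (C : ℝ) (q : ℕ) : Prop :=
  (∀ᶠ μ : ℝ in atTop, v μ ≠ ∞) ∧
    (fun μ : ℝ => (v μ).toReal - C * μ ^ (-(q : ℤ) + 1)) =O[atTop] fun μ : ℝ => μ ^ (-(q : ℤ))

end PeriodicSchrodinger

end

/-!
The asymptotics come from an exact conjugation of `H = Δ + μ V` to a block-diagonal operator for
large `μ`. With `ε = μ⁻¹` and `V = ∑ₐ vₐ Pₐ`, where the `Pₐ` project onto the cosets of the period
lattice and the `vₐ` are distinct by non-degeneracy, the equation `(V + ε Δ) U = U (V + ε D)` with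
`D` commuting with all `Pₐ` and `U` normalized to have diagonal blocks `1` determines the Taylor
coefficients `Uₖ` and `Dₖ` recursively (`conjCoeff`, `diagCoeff`, `commutator_conjCoeff`). The
recursion is quadratic, so Catalan numbers majorize its solution, and the series converge for small `ε`
(`exists_norm_conjCoeff_le`, `conj_eq_of_summable`).

The position operator enters through pairs `(T, [Xᵢ, T])`, which form a Banach algebra `OpPair`: the
same series taken there conjugates `H` together with its commutator. The block-diagonal operator
acts on each coset by a convolution, hence commutes with its commutator `D'` with `Xᵢ`
(`commute_of_entry_periodic`), and the exponential of the pair is explicit (`snd_exp_smul_conj`):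
`Xᵢ exp (-itH) ψ` is `-it exp (-itH) U D' U⁻¹ ψ` up to a bounded error. As `exp (-itH)` is unitary,
the asymptotic velocity of `ψ` is `(∑ᵢ ‖U D'ᵢ U⁻¹ ψ‖²)^(1/2)` (`asympVelocityAt_eq`).

Finally `Dₖ` has range at most `k + 1`, and distinct points of one coset have distance at least
`p₀`. So `[Xᵢ, Dₖ] = 0` for `k < p₀ - 1`, and `U D'ᵢ U⁻¹ = ε ^ (p₀ - 1) Bᵢ + O(ε ^ p₀)` with
`Bᵢ = [Xᵢ, D_{p₀ - 1}]` independent of `μ` (`exists_velocity_operator`). The constants are the norms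
of `(Bᵢ)ᵢ` at `δ₀` and over all normalized states in the domain. They are positive: if `pᵢ = p₀`,
only the straight path of length `p₀` contributes to the entry of `D_{p₀ - 1}` between `0` and
`-p₀ eᵢ`, and its contribution is a product of nonzero factors
(`entry_conjCoeff_single_ne_zero`).
-/

noncomputable section

namespace PeriodicSchrodinger

/-! ### Block diagonalization in an algebra -/

section BlockDiag

variable {ι A : Type*} [Fintype ι] [Ring A]

/-- The block-diagonal part `∑ₐ Pₐ T Pₐ` of `T` with respect to a family of idempotents. -/
def blockDiag (P : ι → A) (T : A) : A := ∑ a, P a * T * P a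

variable {P : ι → A}

theorem mul_blockDiag [DecidableEq ι] (hP : OrthogonalIdempotents P) (a : ι) (T : A) :
    P a * blockDiag P T = P a * T * P a := by
  rw [blockDiag, Finset.mul_sum, Finset.sum_eq_single a]
  · rw [← mul_assoc, ← mul_assoc, (hP.idem a).eq]
  · intro b _ hb
    rw [← mul_assoc, ← mul_assoc, hP.ortho hb.symm, zero_mul, zero_mul]
  · simp

theorem blockDiag_mul [DecidableEq ι] (hP : OrthogonalIdempotents P) (a : ι) (T : A) :
    blockDiag P T * P a = P a * T * P a := by
  rw [blockDiag, Finset.sum_mul, Finset.sum_eq_single a]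
  · rw [mul_assoc, (hP.idem a).eq]
  · intro b _ hb
    rw [mul_assoc, hP.ortho hb, mul_zero]
  · simp

theorem commute_blockDiag [DecidableEq ι] (hP : OrthogonalIdempotents P) (a : ι) (T : A) :
    Commute (P a) (blockDiag P T) := by
  rw [Commute, SemiconjBy, mul_blockDiag hP, blockDiag_mul hP]

/-- Two elements with the same blocks `Pₐ T P_b` are equal. -/
theorem eq_of_blocks_eq (hP : CompleteOrthogonalIdempotents P) {S T : A}
    (h : ∀ a b, P a * S * P b = P a * T * P b) : S = T := by
  have key : ∀ X : A, X = ∑ a, ∑ b, P a * X * P b := fun X => by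
    simp_rw [← Finset.mul_sum, hP.complete, mul_one, ← Finset.sum_mul, hP.complete, one_mul]
  rw [key S, key T]
  simp_rw [h]

theorem norm_blockDiag_le {A : Type*} [NormedRing A] (P : ι → A) (T : A) :
    ‖blockDiag P T‖ ≤ (∑ a, ‖P a‖ * ‖P a‖) * ‖T‖ := by
  rw [Finset.sum_mul]
  refine norm_sum_le_of_le _ fun a _ => ?_
  calc ‖P a * T * P a‖ ≤ ‖P a‖ * ‖T‖ * ‖P a‖ := norm_mul₃_le ..
    _ = _ := by ring

end BlockDiag

section BlockAlgebra

variable {ι A : Type*} [Fintype ι] [Ring A] [Algebra ℂ A]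

/-- The solution `S` with vanishing diagonal blocks of `[∑ₐ vₐ Pₐ, S] = T - blockDiag P T`. The
diagonal terms vanish because `0⁻¹ = 0`. -/
def blockSolve (P : ι → A) (v : ι → ℂ) (T : A) : A :=
  ∑ a, ∑ b, (v a - v b)⁻¹ • (P a * T * P b)

/-- The Taylor coefficients `Uₖ` of the transformation `U = ∑ₖ εᵏ Uₖ` which conjugates
`∑ₐ vₐ Pₐ + ε Δ` to block-diagonal form, normalized by `blockDiag P U = 1`. -/
def conjCoeff (P : ι → A) (v : ι → ℂ) (Δ : A) : ℕ → A
  | 0 => 1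
  | k + 1 => blockSolve P v
      (∑ j : Fin (k + 1), conjCoeff P v Δ j * blockDiag P (Δ * conjCoeff P v Δ (k - j))
        - Δ * conjCoeff P v Δ k)

/-- The Taylor coefficients `Dₖ` of the block-diagonal form `∑ₐ vₐ Pₐ + ε ∑ₖ εᵏ Dₖ`. -/
def diagCoeff (P : ι → A) (v : ι → ℂ) (Δ : A) (k : ℕ) : A :=
  blockDiag P (Δ * conjCoeff P v Δ k)

variable {P : ι → A} {v : ι → ℂ} {Δ : A}

@[simp] theorem conjCoeff_zero : conjCoeff P v Δ 0 = 1 := by rw [conjCoeff]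

theorem conjCoeff_succ (k : ℕ) : conjCoeff P v Δ (k + 1) = blockSolve P v
    (∑ j ∈ Finset.range (k + 1), conjCoeff P v Δ j * diagCoeff P v Δ (k - j)
      - Δ * conjCoeff P v Δ k) := by
  rw [conjCoeff, Finset.sum_range]
  rfl

theorem map_blockDiag {B : Type*} [Ring B] [Algebra ℂ B] (f : A →ₐ[ℂ] B) (T : A) :
    f (blockDiag P T) = blockDiag (fun a => f (P a)) (f T) := by
  simp [blockDiag]

theorem map_blockSolve {B : Type*} [Ring B] [Algebra ℂ B] (f : A →ₐ[ℂ] B) (T : A) :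
    f (blockSolve P v T) = blockSolve (fun a => f (P a)) v (f T) := by
  simp [blockSolve]

theorem map_conjCoeff {B : Type*} [Ring B] [Algebra ℂ B] (f : A →ₐ[ℂ] B) (k : ℕ) :
    f (conjCoeff P v Δ k) = conjCoeff (fun a => f (P a)) v (f Δ) k := by
  induction k using Nat.strong_induction_on with
  | _ k ih =>
    cases k with
    | zero => simp
    | succ k =>
      rw [conjCoeff_succ, conjCoeff_succ, map_blockSolve, map_sub, map_sum, map_mul,
        ih k (by omega)]
      congr 2
      refine Finset.sum_congr rfl fun j hj => ?_
      rw [Finset.mem_range] at hj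
      rw [map_mul, ih j (by omega), diagCoeff, diagCoeff, map_blockDiag, map_mul,
        ih (k - j) (by omega)]

theorem map_diagCoeff {B : Type*} [Ring B] [Algebra ℂ B] (f : A →ₐ[ℂ] B) (k : ℕ) :
    f (diagCoeff P v Δ k) = diagCoeff (fun a => f (P a)) v (f Δ) k := by
  rw [diagCoeff, diagCoeff, map_blockDiag, map_mul, map_conjCoeff]

theorem blockDiag_mem {S : Subalgebra ℂ A} (hP : ∀ a, P a ∈ S) {T : A} (hT : T ∈ S) :
    blockDiag P T ∈ S :=
  S.sum_mem fun a _ => S.mul_mem (S.mul_mem (hP a) hT) (hP a)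

theorem conjCoeff_mem {S : Subalgebra ℂ A} (hP : ∀ a, P a ∈ S) (hΔ : Δ ∈ S) (k : ℕ) :
    conjCoeff P v Δ k ∈ S := by
  induction k using Nat.strong_induction_on with
  | _ k ih =>
    cases k with
    | zero => simp [S.one_mem]
    | succ k =>
      rw [conjCoeff_succ]
      refine S.sum_mem fun a _ => S.sum_mem fun b _ => S.smul_mem
        (S.mul_mem (S.mul_mem (hP a) (S.sub_mem (S.sum_mem fun j hj => ?_) ?_)) (hP b)) _
      · rw [Finset.mem_range] at hj
        exact S.mul_mem (ih j (by omega))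
          (blockDiag_mem hP (S.mul_mem hΔ (ih (k - j) (by omega))))
      · exact S.mul_mem hΔ (ih k (by omega))

theorem diagCoeff_mem {S : Subalgebra ℂ A} (hP : ∀ a, P a ∈ S) (hΔ : Δ ∈ S) (k : ℕ) :
    diagCoeff P v Δ k ∈ S :=
  blockDiag_mem hP (S.mul_mem hΔ (conjCoeff_mem hP hΔ k))

theorem mul_blockSolve_mul [DecidableEq ι] (hP : OrthogonalIdempotents P) (a b : ι) (T : A) :
    P a * blockSolve P v T * P b = (v a - v b)⁻¹ • (P a * T * P b) := by
  rw [blockSolve, Finset.mul_sum, Finset.sum_mul, Finset.sum_eq_single a]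
  · rw [Finset.mul_sum, Finset.sum_mul, Finset.sum_eq_single b]
    · rw [mul_smul_comm, smul_mul_assoc]
      congr 1
      rw [← mul_assoc, ← mul_assoc, (hP.idem a).eq, mul_assoc, (hP.idem b).eq]
    · intro c _ hc
      rw [mul_smul_comm, smul_mul_assoc, mul_assoc, mul_assoc, hP.ortho hc]
      simp
    · simp
  · intro c _ hc
    rw [Finset.mul_sum, Finset.sum_mul]
    refine Finset.sum_eq_zero fun e _ => ?_
    rw [mul_smul_comm, smul_mul_assoc, ← mul_assoc, ← mul_assoc, hP.ortho hc.symm]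
    simp
  · simp

theorem mul_sum_smul [DecidableEq ι] (hP : OrthogonalIdempotents P) (a : ι) :
    P a * ∑ b, v b • P b = v a • P a := by
  rw [Finset.mul_sum, Finset.sum_eq_single a]
  · rw [mul_smul_comm, (hP.idem a).eq]
  · intro b _ hb
    rw [mul_smul_comm, hP.ortho hb.symm, smul_zero]
  · simp

theorem sum_smul_mul [DecidableEq ι] (hP : OrthogonalIdempotents P) (a : ι) :
    (∑ b, v b • P b) * P a = v a • P a := by
  rw [Finset.sum_mul, Finset.sum_eq_single a]
  · rw [smul_mul_assoc, (hP.idem a).eq]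
  · intro b _ hb
    rw [smul_mul_assoc, hP.ortho hb, smul_zero]
  · simp

theorem mul_conjCoeff_mul_self [DecidableEq ι] (hP : OrthogonalIdempotents P) (a : ι) (k : ℕ) :
    P a * conjCoeff P v Δ (k + 1) * P a = 0 := by
  rw [conjCoeff_succ, mul_blockSolve_mul hP, sub_self, inv_zero, zero_smul]

/-- The recursion for the coefficients, read as the identity of the coefficients of `εᵏ⁺¹` in
`(V + ε Δ) U = U (V + ε D)` with `V = ∑ₐ vₐ Pₐ`. -/
theorem commutator_conjCoeff [DecidableEq ι] (hP : CompleteOrthogonalIdempotents P)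
    (hv : Function.Injective v) (k : ℕ) :
    (∑ a, v a • P a) * conjCoeff P v Δ (k + 1) - conjCoeff P v Δ (k + 1) * ∑ a, v a • P a
      = ∑ j ∈ Finset.range (k + 1), conjCoeff P v Δ j * diagCoeff P v Δ (k - j)
        - Δ * conjCoeff P v Δ k := by
  have hO := hP.toOrthogonalIdempotents
  refine eq_of_blocks_eq hP fun a b => ?_
  have hl : P a * ((∑ a, v a • P a) * conjCoeff P v Δ (k + 1)
      - conjCoeff P v Δ (k + 1) * ∑ a, v a • P a) * P b
      = (v a - v b) • (P a * conjCoeff P v Δ (k + 1) * P b) := by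
    rw [mul_sub, sub_mul, ← mul_assoc, mul_sum_smul hO, mul_assoc (P a) (_ * _) (P b),
      mul_assoc (conjCoeff P v Δ (k + 1)) _ (P b), sum_smul_mul hO, sub_smul, smul_mul_assoc, smul_mul_assoc, mul_smul_comm, mul_smul_comm,
      mul_assoc (P a)]
  rw [hl]
  rcases eq_or_ne a b with rfl | hab
  · -- On the diagonal blocks only the term `j = 0` of the sum survives.
    rw [sub_self, zero_smul, Finset.sum_range_succ', conjCoeff_zero, one_mul, Nat.sub_zero,
      mul_sub, mul_add, sub_mul, add_mul, diagCoeff.eq_def P v Δ k, mul_blockDiag hO,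
      mul_assoc _ (P a) (P a), (hO.idem a).eq, add_sub_cancel_right, Finset.mul_sum,
      Finset.sum_mul]
    refine (Finset.sum_eq_zero fun j _ => ?_).symm
    rw [mul_assoc, mul_assoc, diagCoeff, ← (commute_blockDiag hO a _).eq, ← mul_assoc, ← mul_assoc,
      mul_conjCoeff_mul_self hO, zero_mul]
  · rw [conjCoeff_succ, mul_blockSolve_mul hO, smul_smul,
      mul_inv_cancel₀ (sub_ne_zero.2 (hv.ne hab)), one_smul]

end BlockAlgebra

section BlockSeries

variable {ι A : Type*} [Fintype ι] [NormedRing A] [NormedAlgebra ℂ A]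

theorem norm_blockSolve_le (P : ι → A) (v : ι → ℂ) (T : A) :
    ‖blockSolve P v T‖ ≤ (∑ a, ∑ b, ‖(v a - v b)⁻¹‖ * (‖P a‖ * ‖P b‖)) * ‖T‖ := by
  rw [Finset.sum_mul]
  refine norm_sum_le_of_le _ fun a _ => ?_
  rw [Finset.sum_mul]
  refine norm_sum_le_of_le _ fun b _ => ?_
  have h : ‖P a * T * P b‖ ≤ ‖P a‖ * ‖P b‖ * ‖T‖ :=
    (norm_mul₃_le ..).trans_eq (by ring)
  rw [norm_smul, mul_assoc ‖_‖]
  gcongr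

theorem catalan_le_four_pow (n : ℕ) : catalan n ≤ 4 ^ n := by
  rw [catalan_eq_centralBinom_div]
  refine (Nat.div_le_self _ _).trans ?_
  rw [Nat.centralBinom, show 4 ^ n = 2 ^ (2 * n) by rw [pow_mul]; norm_num]
  exact Nat.choose_le_two_pow _ _

/-- The coefficients grow at most geometrically: the recursion is quadratic, so that they are
majorized by Catalan numbers. -/
theorem exists_norm_conjCoeff_le [NormOneClass A] (P : ι → A) (v : ι → ℂ) (Δ : A) :
    ∃ M : ℝ, 1 ≤ M ∧ ∀ k, ‖conjCoeff P v Δ k‖ ≤ M ^ k ∧ ‖diagCoeff P v Δ k‖ ≤ M * M ^ k := by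
  set α := ∑ a, ‖P a‖ * ‖P a‖
  set β := ∑ a, ∑ b, ‖(v a - v b)⁻¹‖ * (‖P a‖ * ‖P b‖)
  have hα : 0 ≤ α := by positivity
  have hβ : 0 ≤ β := by positivity
  set δ := ‖Δ‖
  have hδ : 0 ≤ δ := norm_nonneg _
  set G := β * (α * δ + δ)
  have hG : 0 ≤ G := by positivity
  have hD : ∀ k, ‖diagCoeff P v Δ k‖ ≤ α * δ * ‖conjCoeff P v Δ k‖ := fun k => by
    refine (norm_blockDiag_le _ _).trans ?_
    rw [mul_assoc]
    gcongr
    exact norm_mul_le _ _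
  have hU : ∀ k, ‖conjCoeff P v Δ k‖ ≤ G ^ k * catalan k := by
    intro k
    induction k using Nat.strong_induction_on with
    | _ k ih =>
      cases k with
      | zero => simp
      | succ k =>
        have hsum : ∀ j ∈ Finset.range (k + 1),
            ‖conjCoeff P v Δ j * diagCoeff P v Δ (k - j)‖
              ≤ α * δ * (G ^ k * (catalan j * catalan (k - j))) := fun j hj => by
          rw [Finset.mem_range] at hj
          calc ‖conjCoeff P v Δ j * diagCoeff P v Δ (k - j)‖
              ≤ ‖conjCoeff P v Δ j‖ * (α * δ * ‖conjCoeff P v Δ (k - j)‖) :=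
                (norm_mul_le _ _).trans (by gcongr; exact hD _)
            _ ≤ (G ^ j * catalan j) * (α * δ * (G ^ (k - j) * catalan (k - j))) := by
                gcongr
                · exact ih j (by omega)
                · exact ih (k - j) (by omega)
            _ = _ := by
                rw [show G ^ k = G ^ j * G ^ (k - j) by rw [← pow_add]; congr 1; omega]
                ring
        have hcat : (catalan (k + 1) : ℝ)
            = ∑ j ∈ Finset.range (k + 1), (catalan j * catalan (k - j) : ℝ) := by
          rw [catalan_succ, Finset.sum_range]
          push_cast
          rfl
        have hlin : ‖Δ * conjCoeff P v Δ k‖ ≤ δ * (G ^ k * catalan (k + 1)) := by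
          refine (norm_mul_le _ _).trans ?_
          gcongr
          refine (ih k (by omega)).trans ?_
          gcongr
          rw [← Nat.cast_le (α := ℝ), hcat, Finset.sum_range_succ']
          simp only [catalan_zero, Nat.cast_one, one_mul, Nat.sub_zero]
          have : (0 : ℝ) ≤ ∑ i ∈ Finset.range k,
            (catalan (i + 1) * catalan (k - (i + 1)) : ℝ) := by positivity
          linarith
        rw [conjCoeff_succ]
        calc _ ≤ β * ‖∑ j ∈ Finset.range (k + 1), conjCoeff P v Δ j * diagCoeff P v Δ (k - j)
              - Δ * conjCoeff P v Δ k‖ := norm_blockSolve_le _ _ _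
          _ ≤ β * (∑ j ∈ Finset.range (k + 1), α * δ * (G ^ k * (catalan j * catalan (k - j)))
              + δ * (G ^ k * catalan (k + 1))) := by
              gcongr
              exact (norm_sub_le _ _).trans (add_le_add (norm_sum_le_of_le _ hsum) hlin)
          _ = _ := by
              rw [← Finset.mul_sum, ← Finset.mul_sum, ← hcat, pow_succ]
              ring
  have hM : ∀ k, ‖conjCoeff P v Δ k‖ ≤ (1 + G * 4 + α * δ) ^ k := fun k => by
    refine (hU k).trans ?_
    calc G ^ k * catalan k ≤ G ^ k * 4 ^ k := by
          gcongr
          exact_mod_cast catalan_le_four_pow k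
      _ = (G * 4) ^ k := (mul_pow _ _ _).symm
      _ ≤ _ := by
          gcongr
          nlinarith [mul_nonneg hα hδ]
  refine ⟨1 + G * 4 + α * δ, by nlinarith [mul_nonneg hα hδ], fun k => ⟨hM k, ?_⟩⟩
  refine (hD k).trans ?_
  gcongr
  · linarith
  · exact hM k

theorem summable_norm_pow_smul {f : ℕ → A} {K M : ℝ} (hM : 0 ≤ M)
    (hf : ∀ k, ‖f k‖ ≤ K * M ^ k) {ε : ℂ} (hε : ‖ε‖ * M ≤ 1 / 2) :
    Summable fun k => ‖ε ^ k • f k‖ := by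
  have hK : 0 ≤ K := by simpa using (norm_nonneg _).trans (hf 0)
  refine Summable.of_nonneg_of_le (fun _ => norm_nonneg _) (fun k => ?_)
    (summable_geometric_two.mul_left K)
  rw [norm_smul, norm_pow]
  calc ‖ε‖ ^ k * ‖f k‖ ≤ ‖ε‖ ^ k * (K * M ^ k) := by gcongr; exact hf k
    _ = K * (‖ε‖ * M) ^ k := by rw [mul_pow]; ring
    _ ≤ K * (1 / 2) ^ k := by gcongr

/-- A power series which starts in degree `q` is its leading term up to an error of order
`q + 1`. -/
theorem norm_tsum_pow_smul_sub_le [CompleteSpace A] {f : ℕ → A} {K M : ℝ} (hM : 0 ≤ M)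
    (hf : ∀ k, ‖f k‖ ≤ K * M ^ k) {q : ℕ} (hq : ∀ k < q, f k = 0) {ε : ℂ}
    (hε : ‖ε‖ * M ≤ 1 / 2) :
    ‖∑' k, ε ^ k • f k - ε ^ q • f q‖ ≤ 2 * K * M ^ (q + 1) * ‖ε‖ ^ (q + 1) := by
  have hK : 0 ≤ K := by simpa using (norm_nonneg _).trans (hf 0)
  have hs := (summable_norm_pow_smul hM hf hε).of_norm
  rw [← hs.sum_add_tsum_nat_add (q + 1), Finset.sum_range_succ,
    Finset.sum_eq_zero fun k hk => by rw [hq k (Finset.mem_range.1 hk), smul_zero], zero_add,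
    add_sub_cancel_left]
  have hg : HasSum (fun k : ℕ => K * M ^ (q + 1) * ‖ε‖ ^ (q + 1) * (1 / 2) ^ k)
      (K * M ^ (q + 1) * ‖ε‖ ^ (q + 1) * 2) := hasSum_geometric_two.mul_left _
  refine (tsum_of_norm_bounded hg fun k => ?_).trans_eq (by ring)
  rw [norm_smul, norm_pow]
  calc ‖ε‖ ^ (k + (q + 1)) * ‖f (k + (q + 1))‖
      ≤ ‖ε‖ ^ (k + (q + 1)) * (K * M ^ (k + (q + 1))) := by gcongr; exact hf _
    _ = K * M ^ (q + 1) * ‖ε‖ ^ (q + 1) * (‖ε‖ * M) ^ k := by rw [mul_pow]; ring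
    _ ≤ _ := by gcongr

variable [CompleteSpace A]

/-- The sums of the two power series conjugate `V + ε Δ` to `V + ε D`, where `V = ∑ₐ vₐ Pₐ`. -/
theorem conj_eq_of_summable [DecidableEq ι] {P : ι → A} (hP : CompleteOrthogonalIdempotents P)
    {v : ι → ℂ} (hv : Function.Injective v) (Δ : A) {ε : ℂ}
    (hU : Summable fun k => ‖ε ^ k • conjCoeff P v Δ k‖)
    (hD : Summable fun k => ‖ε ^ k • diagCoeff P v Δ k‖) :
    (∑ a, v a • P a + ε • Δ) * ∑' k, ε ^ k • conjCoeff P v Δ k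
      = (∑' k, ε ^ k • conjCoeff P v Δ k)
        * (∑ a, v a • P a + ε • ∑' k, ε ^ k • diagCoeff P v Δ k) := by
  have hUs := hU.of_norm
  have hprod := tsum_mul_tsum_eq_tsum_sum_range_of_summable_norm hU hD
  have hprod_summable := (summable_norm_sum_mul_range_of_summable_norm hU hD).of_norm
  set V := ∑ a, v a • P a
  set U := ∑' k, ε ^ k • conjCoeff P v Δ k with hUdef
  set D := ∑' k, ε ^ k • diagCoeff P v Δ k with hDdef
  have h1 : V * U - U * V
      = ∑' k, ε ^ (k + 1) • (V * conjCoeff P v Δ (k + 1) - conjCoeff P v Δ (k + 1) * V) := by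
    rw [hUdef, ← hUs.tsum_mul_left, ← hUs.tsum_mul_right,
      ← (hUs.mul_left V).tsum_sub (hUs.mul_right V),
      ((hUs.mul_left V).sub (hUs.mul_right V)).tsum_eq_zero_add]
    simp [smul_sub]
  have h2 : U * D - Δ * U = ∑' k, ε ^ k •
      (∑ j ∈ Finset.range (k + 1), conjCoeff P v Δ j * diagCoeff P v Δ (k - j)
        - Δ * conjCoeff P v Δ k) := by
    rw [hprod, hUdef, ← hUs.tsum_mul_left, ← hprod_summable.tsum_sub (hUs.mul_left Δ)]
    refine tsum_congr fun k => ?_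
    rw [smul_sub, mul_smul_comm, Finset.smul_sum]
    congr 1
    refine Finset.sum_congr rfl fun j hj => ?_
    rw [Finset.mem_range] at hj
    rw [smul_mul_smul_comm, ← pow_add]
    congr 2
    omega
  have h3 : V * U - U * V = ε • (U * D - Δ * U) := by
    rw [h1, h2, ← tsum_const_smul'']
    refine tsum_congr fun k => ?_
    rw [commutator_conjCoeff hP hv, pow_succ', smul_smul]
  rw [add_mul, mul_add, smul_mul_assoc, mul_smul_comm]
  rw [smul_sub, sub_eq_sub_iff_add_eq_add] at h3
  rw [h3, add_comm]

end BlockSeries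

/-! ### Matrix entries of operators on the lattice -/

section Entries

variable {d : ℕ}

/-- Bounded operators on `ℓ²(ℤ^d)`. -/
abbrev Op (d : ℕ) : Type := Hilb d →L[ℂ] Hilb d

/-- The unit vector `δₘ` supported at `m`. -/
abbrev delta (m : Lat d) : Hilb d := lp.single 2 m 1

/-- The matrix entry `⟨δₙ, T δₘ⟩ = (T δₘ)(n)`. -/
def entry (T : Op d) (n m : Lat d) : ℂ := T (delta m) n

instance : Nontrivial (Hilb d) :=
  ⟨delta 0, 0, fun h => by simpa using congrArg (fun ψ : Hilb d => ψ 0) h⟩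

theorem delta_apply (m n : Lat d) : delta m n = if n = m then (1 : ℂ) else 0 := by
  rw [lp.single_apply, Pi.single_apply]

theorem hasSum_apply (T : Op d) (ψ : Hilb d) (n : Lat d) :
    HasSum (fun l => entry T n l * ψ l) (T ψ n) := by
  have h := (lp.hasSum_single (by norm_num) ψ).mapL
    ((lp.evalCLM ℂ (fun _ : Lat d => ℂ) 2 n).comp T)
  have h1 : ∀ l, (lp.evalCLM ℂ (fun _ : Lat d => ℂ) 2 n).comp T (lp.single 2 l (ψ l))
      = entry T n l * ψ l := fun l => by
    rw [show lp.single 2 l (ψ l) = ψ l • delta l by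
      rw [← lp.single_smul, smul_eq_mul, mul_one], map_smul, smul_eq_mul, mul_comm]
    rfl
  simp only [h1] at h
  exact h

theorem entry_mul (S T : Op d) (n m : Lat d) :
    entry (S * T) n m = ∑' l, entry S n l * entry T l m :=
  (hasSum_apply S (T (delta m)) n).tsum_eq.symm

theorem ext_entry {S T : Op d} (h : ∀ n m, entry S n m = entry T n m) : S = T := by
  ext ψ n
  exact (hasSum_apply S ψ n).unique (by simpa only [h] using hasSum_apply T ψ n)

@[simp] theorem entry_add (S T : Op d) (n m : Lat d) :
    entry (S + T) n m = entry S n m + entry T n m := rfl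

@[simp] theorem entry_sub (S T : Op d) (n m : Lat d) :
    entry (S - T) n m = entry S n m - entry T n m := rfl

@[simp] theorem entry_smul (c : ℂ) (T : Op d) (n m : Lat d) :
    entry (c • T) n m = c * entry T n m := rfl

@[simp] theorem entry_zero (n m : Lat d) : entry (0 : Op d) n m = 0 := rfl

theorem entry_one (n m : Lat d) : entry (1 : Op d) n m = if n = m then 1 else 0 :=
  delta_apply m n

theorem entry_sum {ι : Type*} (s : Finset ι) (T : ι → Op d) (n m : Lat d) :
    entry (∑ a ∈ s, T a) n m = ∑ a ∈ s, entry (T a) n m := by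
  classical
  induction s using Finset.induction_on with
  | empty => simp
  | insert a s ha ih => rw [Finset.sum_insert ha, Finset.sum_insert ha, entry_add, ih]

theorem entry_star (T : Op d) (n m : Lat d) :
    entry (star T) n m = starRingEnd ℂ (entry T m n) := by
  have h1 : entry (star T) n m = inner ℂ (delta n) (star T (delta m)) := by
    rw [lp.inner_single_left]
    simp [entry]
  rw [h1, ContinuousLinearMap.star_eq_adjoint, ContinuousLinearMap.adjoint_inner_right,
    ← inner_conj_symm, lp.inner_single_left]
  simp [entry]

theorem translation_apply (e : Lat d) (ψ : Hilb d) (n : Lat d) :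
    translation e ψ n = ψ (n + e) := rfl

theorem potential_apply (W : Lat d → ℝ) (hW : ∃ C : ℝ, ∀ n, |W n| ≤ C) (ψ : Hilb d)
    (n : Lat d) : potential W hW ψ n = W n * ψ n := rfl

theorem entry_translation (e n m : Lat d) :
    entry (translation e) n m = if n + e = m then 1 else 0 :=
  delta_apply m (n + e)

theorem potential_delta (W : Lat d → ℝ) (hW : ∃ C : ℝ, ∀ n, |W n| ≤ C) (m : Lat d) :
    potential W hW (delta m) = (W m : ℂ) • delta m := by
  ext n
  rw [potential_apply, lp.coeFn_smul, Pi.smul_apply, delta_apply, smul_eq_mul]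
  split_ifs with h
  · rw [h]
  · simp

theorem entry_potential (W : Lat d → ℝ) (hW : ∃ C : ℝ, ∀ n, |W n| ≤ C) (n m : Lat d) :
    entry (potential W hW) n m = if n = m then (W n : ℂ) else 0 := by
  rw [entry, potential_apply, delta_apply]
  split_ifs <;> simp

theorem entry_potential_mul (W : Lat d → ℝ) (hW : ∃ C : ℝ, ∀ n, |W n| ≤ C) (T : Op d)
    (n m : Lat d) : entry (potential W hW * T) n m = W n * entry T n m := rfl

theorem entry_mul_potential (W : Lat d → ℝ) (hW : ∃ C : ℝ, ∀ n, |W n| ≤ C) (T : Op d)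
    (n m : Lat d) : entry (T * potential W hW) n m = entry T n m * W m := by
  rw [entry, mul_apply_eq_comp, potential_delta, map_smul, mul_comm]
  rfl

theorem laplacian_apply (ψ : Hilb d) (n : Lat d) : laplacian d ψ n
    = ∑ i : Fin d, (ψ (n + Pi.single i 1) + ψ (n - Pi.single i 1)) := by
  have h := hamiltonian_apply (fun _ => 0) ⟨0, by simp⟩ 0 ψ n
  simpa [hamiltonian] using h

theorem entry_laplacian_mul (T : Op d) (n m : Lat d) : entry (laplacian d * T) n m
    = ∑ i : Fin d, (entry T (n + Pi.single i 1) m + entry T (n - Pi.single i 1) m) :=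
  laplacian_apply _ _

theorem isSelfAdjoint_potential (W : Lat d → ℝ) (hW : ∃ C : ℝ, ∀ n, |W n| ≤ C) :
    IsSelfAdjoint (potential W hW) := by
  refine ext_entry fun n m => ?_
  rw [entry_star, entry_potential, entry_potential]
  rcases eq_or_ne n m with rfl | h
  · simp
  · simp [h, h.symm]

theorem star_translation (e : Lat d) : star (translation e) = translation (-e) := by
  refine ext_entry fun n m => ?_
  rw [entry_star, entry_translation, entry_translation]
  have : m + e = n ↔ n + -e = m := by
    rw [← sub_eq_add_neg, sub_eq_iff_eq_add, eq_comm]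
  simp only [this]
  split_ifs <;> simp

theorem isSelfAdjoint_hamiltonian (V : Lat d → ℝ) (hV : ∃ C : ℝ, ∀ n, |V n| ≤ C) (μ : ℝ) :
    IsSelfAdjoint (hamiltonian V hV μ) := by
  refine IsSelfAdjoint.add ?_ (IsSelfAdjoint.smul ?_ (isSelfAdjoint_potential V hV))
  · rw [IsSelfAdjoint, laplacian, star_sum]
    refine Finset.sum_congr rfl fun i _ => ?_
    rw [star_add, star_translation, star_translation, neg_neg, add_comm]
  · exact Complex.conj_ofReal μ

theorem norm_evolution_apply {H : Op d} (hH : IsSelfAdjoint H) (t : ℝ) (ψ : Hilb d) :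
    ‖evolution H t ψ‖ = ‖ψ‖ := by
  have h : evolution H t ∈ unitary (Op d) := by
    have h1 : IsSelfAdjoint ((-t : ℂ) • H) := IsSelfAdjoint.smul (by simp [IsSelfAdjoint]) hH
    let x : selfAdjoint (Op d) := ⟨_, h1⟩
    have h2 := (selfAdjoint.expUnitary x).2
    convert h2 using 1
    rw [selfAdjoint.expUnitary_coe, evolution, smul_smul]
    congr 2
    ring
  exact ContinuousLinearMap.norm_map_of_mem_unitary h ψ

end Entries

/-! ### Periodic operators and colourings of the lattice -/

section Colouring

variable {d : ℕ} {G : Type*} [AddCommGroup G]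

variable (κ : Lat d →+ G)

/-- The operators commuting with the translations by elements of `ker κ`. -/
def periodicOps : Subalgebra ℂ (Op d) :=
  Subalgebra.centralizer ℂ {T | ∃ x, κ x = 0 ∧ T = translation x}

variable {κ}

theorem mem_periodicOps {T : Op d} :
    T ∈ periodicOps κ ↔ ∀ x, κ x = 0 → translation x * T = T * translation x := by
  rw [periodicOps, Subalgebra.mem_centralizer_iff]
  exact ⟨fun h x hx => h _ ⟨x, hx, rfl⟩, by rintro h _ ⟨x, hx, rfl⟩; exact h x hx⟩

variable (κ) in
theorem isClosed_periodicOps : IsClosed (periodicOps κ : Set (Op d)) :=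
  Set.isClosed_centralizer _

theorem entry_add_add_of_mem_periodicOps {T : Op d} (hT : T ∈ periodicOps κ) {x : Lat d}
    (hx : κ x = 0) (n m : Lat d) : entry T (n + x) (m + x) = entry T n m := by
  have h : translation x (delta (m + x)) = delta m := by
    ext n
    rw [translation_apply, delta_apply, delta_apply]
    simp
  have h2 := congrArg (fun X : Op d => X (delta (m + x)) n) (mem_periodicOps.1 hT x hx)
  simp only [mul_apply_eq_comp, translation_apply, h] at h2
  exact h2

theorem laplacian_mem_periodicOps : laplacian d ∈ periodicOps κ := by
  have h : ∀ x e : Lat d, translation x * translation e = translation e * translation x := by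
    intro x e
    ext ψ n
    simp only [mul_apply_eq_comp, translation_apply]
    rw [add_right_comm]
  refine Subalgebra.sum_mem _ fun i _ => Subalgebra.add_mem _ ?_ ?_ <;>
  exact mem_periodicOps.2 fun x _ => h _ _

variable [DecidableEq G]

/-- The projection of `ℓ²(ℤ^d)` onto the functions supported on the coset `κ = a`. -/
def cosetProj (κ : Lat d →+ G) (a : G) : Op d :=
  potential (fun n => if κ n = a then 1 else 0) ⟨1, fun n => by split_ifs <;> simp⟩

variable (κ)

theorem entry_cosetProj_mul (a : G) (T : Op d) (n m : Lat d) :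
    entry (cosetProj κ a * T) n m = if κ n = a then entry T n m else 0 := by
  rw [cosetProj, entry_potential_mul]
  split_ifs <;> simp

theorem entry_mul_cosetProj (a : G) (T : Op d) (n m : Lat d) :
    entry (T * cosetProj κ a) n m = if κ m = a then entry T n m else 0 := by
  rw [cosetProj, entry_mul_potential]
  split_ifs <;> simp

theorem entry_cosetProj (a : G) (n m : Lat d) :
    entry (cosetProj κ a) n m = if κ n = a then (if n = m then 1 else 0) else 0 := by
  rw [← mul_one (cosetProj κ a), entry_cosetProj_mul, entry_one]

theorem completeOrthogonalIdempotents_cosetProj [Fintype G] :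
    CompleteOrthogonalIdempotents (cosetProj κ) where
  idem a := by
    refine ext_entry fun n m => ?_
    rw [entry_cosetProj_mul, entry_cosetProj]
    split_ifs <;> rfl
  ortho a b hab := by
    refine ext_entry fun n m => ?_
    change entry (cosetProj κ a * cosetProj κ b) n m = _
    rw [entry_cosetProj_mul, entry_cosetProj, entry_zero]
    split_ifs with h1 h2 <;> first | rfl | exact absurd (h1.symm.trans h2) hab
  complete := by
    refine ext_entry fun n m => ?_
    simp [entry_sum, entry_cosetProj, entry_one]

theorem entry_blockDiag [Fintype G] (T : Op d) (n m : Lat d) :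
    entry (blockDiag (cosetProj κ) T) n m = if κ n = κ m then entry T n m else 0 := by
  simp only [blockDiag, entry_sum, entry_mul_cosetProj, entry_cosetProj_mul]
  rw [Finset.sum_ite_eq]
  simp

theorem entry_blockSolve [Fintype G] (v : G → ℂ) (T : Op d) (n m : Lat d) :
    entry (blockSolve (cosetProj κ) v T) n m = (v (κ n) - v (κ m))⁻¹ * entry T n m := by
  simp only [blockSolve, entry_sum, entry_smul, entry_mul_cosetProj, entry_cosetProj_mul]
  rw [Finset.sum_eq_single (κ n), Finset.sum_eq_single (κ m)]
  · simp
  · intro b _ hb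
    simp [hb.symm]
  · simp
  · intro a _ ha
    simp [ha.symm]
  · simp

/-- Convolution operators on the cosets of `ker κ`: operators which commute with the
translations by elements of `ker κ` and with the projections onto the cosets commute with each
other. The matrix product is commutative because `l ↦ n + m - l` exchanges the two factors. -/
theorem commute_of_entry_periodic {S T : Op d}
    (hS : ∀ n m, κ n ≠ κ m → entry S n m = 0) (hT : ∀ n m, κ n ≠ κ m → entry T n m = 0)
    (hS' : ∀ x, κ x = 0 → ∀ n m, entry S (n + x) (m + x) = entry S n m)
    (hT' : ∀ x, κ x = 0 → ∀ n m, entry T (n + x) (m + x) = entry T n m) : Commute S T := by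
  refine ext_entry fun n m => ?_
  rw [entry_mul, entry_mul]
  by_cases hnm : κ n = κ m
  · rw [← (Equiv.subLeft (n + m)).tsum_eq]
    refine tsum_congr fun l => ?_
    rw [Equiv.subLeft_apply]
    by_cases hl : κ l = κ m
    · have h1 := hS' (l - n) (by rw [map_sub, hl, hnm, sub_self]) n (n + m - l)
      have h2 := hT' (l - m) (by rw [map_sub, hl, sub_self]) (n + m - l) m
      rw [← h1, ← h2, mul_comm]
      congr 2 <;> abel
    · rw [hT (n + m - l) m, hT n l (by rw [hnm]; exact Ne.symm hl), mul_zero, zero_mul]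
      rw [map_sub, map_add, hnm]
      intro h
      exact hl (by rw [sub_eq_iff_eq_add] at h; exact (add_left_cancel h).symm)
  · have h0 : ∀ {S T : Op d}, (∀ n m, κ n ≠ κ m → entry S n m = 0) →
        (∀ n m, κ n ≠ κ m → entry T n m = 0) → ∑' l, entry S n l * entry T l m = 0 := by
      intro S T hS hT
      refine (tsum_congr fun l => ?_).trans tsum_zero
      by_cases hl : κ n = κ l
      · rw [hT l m (hl ▸ hnm), mul_zero]
      · rw [hS n l hl, zero_mul]
    rw [h0 hS hT, h0 hT hS]

theorem entry_eq_zero_of_commute {T : Op d} (hT : ∀ a, Commute (cosetProj κ a) T) {n m : Lat d}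
    (h : κ n ≠ κ m) : entry T n m = 0 := by
  have := congrArg (fun X => entry X n m) (hT (κ n)).eq
  simpa [entry_cosetProj_mul, entry_mul_cosetProj, h.symm] using this

theorem cosetProj_mem_periodicOps {κ : Lat d →+ G} (a : G) : cosetProj κ a ∈ periodicOps κ := by
  refine mem_periodicOps.2 fun x hx => ?_
  ext ψ n
  simp only [mul_apply_eq_comp, translation_apply, cosetProj, potential_apply, map_add,
    hx, add_zero]

end Colouring

/-! ### Range of the coefficients and the straight path -/

section Range

variable {d : ℕ}

/-- The `ℓ¹` distance `|n - m|₁` on the lattice. -/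
def latDist (n m : Lat d) : ℕ := ∑ i, (n i - m i).natAbs

theorem latDist_triangle (n l m : Lat d) : latDist n m ≤ latDist n l + latDist l m := by
  rw [latDist, latDist, latDist, ← Finset.sum_add_distrib]
  exact Finset.sum_le_sum fun i _ => by omega

theorem sum_natAbs_single (i : Fin d) (a : ℤ) :
    ∑ k, ((Pi.single i a : Lat d) k).natAbs = a.natAbs := by
  rw [Finset.sum_eq_single i]
  · rw [Pi.single_eq_same]
  · intro j _ hj
    rw [Pi.single_eq_of_ne hj, Int.natAbs_zero]
  · simp

theorem latDist_single_zero (i : Fin d) (a : ℤ) :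
    latDist (Pi.single i a) 0 = a.natAbs := by
  simpa [latDist] using sum_natAbs_single i a

theorem latDist_single_add_single_zero {i j : Fin d} (hij : i ≠ j) (a b : ℤ) :
    latDist (Pi.single i a + Pi.single j b) 0 = a.natAbs + b.natAbs := by
  rw [← sum_natAbs_single i, ← sum_natAbs_single j, ← Finset.sum_add_distrib, latDist]
  refine Finset.sum_congr rfl fun k _ => ?_
  rcases eq_or_ne k i with rfl | hk
  · simp [Pi.single_eq_of_ne hij]
  · simp [Pi.single_eq_of_ne hk]

theorem latDist_le_add_single (n m : Lat d) (i : Fin d) :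
    latDist n m ≤ latDist (n + Pi.single i 1) m + 1 := by
  refine (latDist_triangle n (n + Pi.single i 1) m).trans ?_
  have : latDist n (n + Pi.single i 1) = 1 := by
    simpa [latDist] using sum_natAbs_single i 1
  omega

theorem latDist_le_sub_single (n m : Lat d) (i : Fin d) :
    latDist n m ≤ latDist (n - Pi.single i 1) m + 1 := by
  refine (latDist_triangle n (n - Pi.single i 1) m).trans ?_
  have : latDist n (n - Pi.single i 1) = 1 := by
    simpa [latDist] using sum_natAbs_single i 1
  omega

/-- `T` has range at most `k`: its matrix entries vanish beyond `ℓ¹` distance `k`. -/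
def HasRange (T : Op d) (k : ℕ) : Prop := ∀ n m, k < latDist n m → entry T n m = 0

theorem hasRange_one : HasRange (1 : Op d) 0 := by
  intro n m h
  rw [entry_one, if_neg]
  rintro rfl
  simp [latDist] at h

theorem HasRange.mono {T : Op d} {j k : ℕ} (hT : HasRange T j) (h : j ≤ k) : HasRange T k :=
  fun n m hnm => hT n m (h.trans_lt hnm)

theorem HasRange.mul {S T : Op d} {j k : ℕ} (hS : HasRange S j) (hT : HasRange T k) :
    HasRange (S * T) (j + k) := by
  intro n m h
  rw [entry_mul]
  refine (tsum_congr fun l => ?_).trans tsum_zero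
  have := latDist_triangle n l m
  by_cases hl : j < latDist n l
  · rw [hS n l hl, zero_mul]
  · rw [hT l m (by omega), mul_zero]

theorem HasRange.laplacian_mul {T : Op d} {k : ℕ} (hT : HasRange T k) :
    HasRange (laplacian d * T) (k + 1) := by
  intro n m h
  rw [entry_laplacian_mul]
  refine Finset.sum_eq_zero fun i _ => ?_
  have h1 := latDist_le_add_single n m i
  have h2 := latDist_le_sub_single n m i
  rw [hT _ _ (by omega), hT _ _ (by omega), add_zero]

/-- Among the neighbours of `-(r + 1) eᵢ` only `-r eᵢ` is within distance `r` of the origin. -/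
theorem HasRange.entry_laplacian_mul_single {T : Op d} {r : ℕ} (hT : HasRange T r) (i : Fin d) :
    entry (laplacian d * T) (Pi.single i (-((r + 1 : ℕ) : ℤ))) 0
      = entry T (Pi.single i (-(r : ℤ))) 0 := by
  rw [entry_laplacian_mul, Finset.sum_eq_single i]
  · rw [← Pi.single_add, ← Pi.single_sub, hT (Pi.single i (_ - _)), add_zero]
    · congr 2
      push_cast
      ring
    · rw [latDist_single_zero]
      omega
  · intro j _ hj
    rw [sub_eq_add_neg, ← Pi.single_neg, hT, hT, add_zero] <;>
    · rw [latDist_single_add_single_zero hj.symm]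
      omega
  · simp

variable {G : Type*} [AddCommGroup G] [DecidableEq G] [Fintype G] {κ : Lat d →+ G} {v : G → ℂ}

theorem HasRange.blockDiag {T : Op d} {k : ℕ} (hT : HasRange T k) :
    HasRange (blockDiag (cosetProj κ) T) k := by
  intro n m h
  rw [entry_blockDiag, hT n m h, ite_self]

theorem hasRange_conjCoeff (k : ℕ) :
    HasRange (conjCoeff (cosetProj κ) v (laplacian d) k) k := by
  induction k using Nat.strong_induction_on with
  | _ k ih =>
    cases k with
    | zero => simpa using hasRange_one
    | succ k =>
      intro n m h
      rw [conjCoeff_succ, entry_blockSolve, entry_sub, entry_sum,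
        (ih k (by omega)).laplacian_mul n m h, Finset.sum_eq_zero, sub_zero, mul_zero]
      intro j hj
      rw [Finset.mem_range] at hj
      exact (((ih j (by omega)).mul (ih (k - j) (by omega)).laplacian_mul.blockDiag).mono
        (by omega)) n m h

theorem hasRange_diagCoeff (k : ℕ) :
    HasRange (diagCoeff (cosetProj κ) v (laplacian d) k) (k + 1) :=
  (hasRange_conjCoeff k).laplacian_mul.blockDiag

theorem entry_diagCoeff_eq_zero {q : ℕ}
    (hq : ∀ n m, κ n = κ m → latDist n m < q + 1 → n = m) {k : ℕ} (hk : k < q) {n m : Lat d}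
    (hnm : n ≠ m) : entry (diagCoeff (cosetProj κ) v (laplacian d) k) n m = 0 := by
  by_cases h : κ n = κ m
  · refine hasRange_diagCoeff k n m ?_
    have := mt (hq n m h) hnm
    omega
  · rw [diagCoeff, entry_blockDiag, if_neg h]

/-- The only contribution of order `r` to the entry between points at distance `r` on a common
axis comes from the straight path, and it does not vanish. -/
theorem entry_conjCoeff_single_ne_zero (hv : Function.Injective v) {q : ℕ}
    (hq : ∀ n m, κ n = κ m → latDist n m < q + 1 → n = m) (i : Fin d) {r : ℕ} (hr : r ≤ q) :
    entry (conjCoeff (cosetProj κ) v (laplacian d) r) (Pi.single i (-(r : ℤ))) 0 ≠ 0 := by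
  induction r with
  | zero => simp [entry_one]
  | succ r ih =>
    have hdist : latDist (Pi.single i (-((r + 1 : ℕ) : ℤ)) : Lat d) 0 = r + 1 := by
      rw [latDist_single_zero]
      omega
    have hne : κ (Pi.single i (-((r + 1 : ℕ) : ℤ))) ≠ κ 0 := fun h => by
      have h0 := hq _ _ h (by omega)
      rw [h0] at hdist
      simp [latDist] at hdist
    rw [conjCoeff_succ, entry_blockSolve, entry_sub, entry_sum, Finset.sum_eq_zero, zero_sub,
      (hasRange_conjCoeff r).entry_laplacian_mul_single]
    · exact mul_ne_zero (inv_ne_zero (sub_ne_zero.2 (hv.ne hne))) (neg_ne_zero.2 (ih (by omega)))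
    · -- In `Uⱼ Dᵣ₋ⱼ` the second factor is still diagonal, the first one has too short a range.
      intro j hj
      rw [Finset.mem_range] at hj
      rw [entry_mul]
      refine (tsum_congr fun l => ?_).trans tsum_zero
      rcases eq_or_ne l 0 with rfl | hl
      · rw [hasRange_conjCoeff j _ _ (by omega), zero_mul]
      · rw [entry_diagCoeff_eq_zero hq (by omega) hl, mul_zero]

theorem entry_diagCoeff_single_ne_zero (hv : Function.Injective v) {q : ℕ}
    (hq : ∀ n m, κ n = κ m → latDist n m < q + 1 → n = m) {i : Fin d}
    (hi : κ (Pi.single i (-((q + 1 : ℕ) : ℤ))) = 0) :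
    entry (diagCoeff (cosetProj κ) v (laplacian d) q)
      (Pi.single i (-((q + 1 : ℕ) : ℤ))) 0 ≠ 0 := by
  rw [diagCoeff, entry_blockDiag, if_pos (by rw [hi, map_zero]),
    (hasRange_conjCoeff q).entry_laplacian_mul_single]
  exact entry_conjCoeff_single_ne_zero hv hq i le_rfl

end Range

/-! ### Operators paired with their commutators with a position operator -/

section Pairs

variable {d : ℕ}

/-- Pairs `(T, T')` of bounded operators with the product `(S, S') (T, T') = (S T, S T' + S' T)`,
under which `T ↦ (T, [Xᵢ, T])` is multiplicative. -/
def OpPair (d : ℕ) : Type := TrivSqZeroExt (Op d) (Op d)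

namespace OpPair

instance : NormedRing (OpPair d) := inferInstanceAs (NormedRing (TrivSqZeroExt (Op d) (Op d)))

instance : NormedAlgebra ℂ (OpPair d) :=
  inferInstanceAs (NormedAlgebra ℂ (TrivSqZeroExt (Op d) (Op d)))

instance : CompleteSpace (OpPair d) :=
  inferInstanceAs (CompleteSpace (TrivSqZeroExt (Op d) (Op d)))

instance : NormOneClass (OpPair d) :=
  inferInstanceAs (NormOneClass (TrivSqZeroExt (Op d) (Op d)))

/-- The operator `T` of the pair `(T, T')`. -/
def fst (T : OpPair d) : Op d := TrivSqZeroExt.fst T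

/-- The operator `T'` of the pair `(T, T')`. -/
def snd (T : OpPair d) : Op d := TrivSqZeroExt.snd T

/-- The pair `(S, T)`. -/
def mk (S T : Op d) : OpPair d := (S, T)

@[simp] theorem fst_mk (S T : Op d) : (mk S T).fst = S := rfl

@[simp] theorem snd_mk (S T : Op d) : (mk S T).snd = T := rfl

@[simp] theorem fst_one : (1 : OpPair d).fst = 1 := rfl

@[simp] theorem snd_one : (1 : OpPair d).snd = 0 := rfl

@[simp] theorem fst_add (S T : OpPair d) : (S + T).fst = S.fst + T.fst := rfl

@[simp] theorem snd_add (S T : OpPair d) : (S + T).snd = S.snd + T.snd := rfl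

@[simp] theorem fst_sub (S T : OpPair d) : (S - T).fst = S.fst - T.fst := rfl

@[simp] theorem fst_smul (c : ℂ) (T : OpPair d) : (c • T).fst = c • T.fst := rfl

@[simp] theorem snd_smul (c : ℂ) (T : OpPair d) : (c • T).snd = c • T.snd := rfl

@[simp] theorem fst_mul (S T : OpPair d) : (S * T).fst = S.fst * T.fst := rfl

@[simp] theorem snd_mul (S T : OpPair d) : (S * T).snd = S.fst * T.snd + S.snd * T.fst := rfl

theorem ext {S T : OpPair d} (h : S.fst = T.fst) (h' : S.snd = T.snd) : S = T :=
  TrivSqZeroExt.ext h h'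

theorem norm_def (T : OpPair d) : ‖T‖ = ‖T.fst‖ + ‖T.snd‖ := TrivSqZeroExt.norm_def T

theorem norm_fst_le (T : OpPair d) : ‖T.fst‖ ≤ ‖T‖ := by
  rw [norm_def]
  exact le_add_of_nonneg_right (norm_nonneg _)

theorem norm_snd_le (T : OpPair d) : ‖T.snd‖ ≤ ‖T‖ := by
  rw [norm_def]
  exact le_add_of_nonneg_left (norm_nonneg _)

/-- `(T, T') ↦ T` as a homomorphism of algebras. -/
def fstHom : OpPair d →ₐ[ℂ] Op d := TrivSqZeroExt.fstHom ℂ (Op d) (Op d)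

@[simp] theorem fstHom_apply (T : OpPair d) : fstHom T = T.fst := rfl

/-- `T ↦ (T, 0)` as a homomorphism of algebras. -/
def inlHom : Op d →ₐ[ℂ] OpPair d := TrivSqZeroExt.inlAlgHom ℂ (Op d) (Op d)

@[simp] theorem snd_inlHom (T : Op d) : (inlHom T).snd = 0 := rfl

/-- `(T, T') ↦ T` as a continuous linear map. -/
def fstCLM : OpPair d →L[ℂ] Op d :=
  LinearMap.mkContinuous fstHom.toLinearMap 1 fun T => (norm_fst_le T).trans_eq (one_mul _).symm

/-- `(T, T') ↦ T'` as a continuous linear map. -/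
def sndCLM : OpPair d →L[ℂ] Op d :=
  LinearMap.mkContinuous { toFun := snd, map_add' := snd_add, map_smul' := snd_smul } 1
    fun T => (norm_snd_le T).trans_eq (one_mul _).symm

@[simp] theorem sndCLM_apply (T : OpPair d) : sndCLM T = T.snd := rfl

theorem exp_of_commute {T : OpPair d} (h : Commute T.fst T.snd) :
    NormedSpace.exp T = mk (NormedSpace.exp T.fst) (NormedSpace.exp T.fst * T.snd) := by
  have h1 := TrivSqZeroExt.exp_def_of_smul_comm (R := Op d) (M := Op d) T h.symm.eq
  have h2 : ∀ a b : Op d, (TrivSqZeroExt.inl a + TrivSqZeroExt.inr b :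
      TrivSqZeroExt (Op d) (Op d)) = mk a b := fun a b => by
    apply TrivSqZeroExt.ext <;> simp <;> rfl
  rw [h2] at h1
  exact h1

theorem fst_exp (T : OpPair d) : (NormedSpace.exp T).fst = NormedSpace.exp T.fst :=
  let : NormedAlgebra ℚ (OpPair d) := .restrictScalars ℚ ℂ _
  NormedSpace.map_exp fstHom fstCLM.continuous T

end OpPair

open OpPair

/-- The pairs `(T, T')` with `T' = [Xᵢ, T]`, in the sense that `T` maps the domain of `Xᵢ` into
itself and `Xᵢ T ψ = T Xᵢ ψ + T' ψ` there. -/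
def positionPairs (i : Fin d) : Subalgebra ℂ (OpPair d) where
  carrier := {T | ∀ ψ φ : Hilb d, (∀ n, φ n = (n i : ℂ) * ψ n) →
    ∀ n, (T.fst φ + T.snd ψ) n = (n i : ℂ) * T.fst ψ n}
  mul_mem' {S T} hS hT ψ φ h n := by
    have h1 := hS _ _ (hT ψ φ h) n
    rw [map_add] at h1
    rw [fst_mul, snd_mul]
    refine Eq.trans ?_ h1
    rw [add_assoc]
    rfl
  add_mem' {S T} hS hT ψ φ h n := by
    have h1 := congrArg₂ (· + ·) (hS ψ φ h n) (hT ψ φ h n)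
    simp only [lp.coeFn_add, Pi.add_apply] at h1
    simp only [fst_add, snd_add, add_apply, lp.coeFn_add, Pi.add_apply]
    linear_combination h1
  algebraMap_mem' c ψ φ h n := by
    have h1 : (algebraMap ℂ (OpPair d) c).fst = c • 1 := by
      rw [Algebra.algebraMap_eq_smul_one, fst_smul, fst_one]
    have h2 : (algebraMap ℂ (OpPair d) c).snd = 0 := by
      rw [Algebra.algebraMap_eq_smul_one, snd_smul, snd_one, smul_zero]
    rw [h1, h2]
    change c * φ n + 0 = n i * (c * ψ n)
    rw [h n]
    ring

theorem isClosed_positionPairs (i : Fin d) : IsClosed (positionPairs i : Set (OpPair d)) := by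
  have h : (positionPairs i : Set (OpPair d)) = ⋂ (ψ : Hilb d) (φ : Hilb d)
      (_ : ∀ n, φ n = (n i : ℂ) * ψ n) (n : Lat d),
      {T : OpPair d | (T.fst φ + T.snd ψ) n = (n i : ℂ) * T.fst ψ n} := by
    ext T
    simp only [Set.mem_iInter]
    rfl
  rw [h]
  have hev : ∀ n : Lat d, Continuous fun ψ : Hilb d => ψ n := fun n =>
    (lp.evalCLM ℂ (fun _ : Lat d => ℂ) 2 n).continuous
  have hfst : ∀ ψ : Hilb d, Continuous fun T : OpPair d => T.fst ψ := fun ψ =>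
    (ContinuousLinearMap.apply ℂ (Hilb d) ψ).continuous.comp fstCLM.continuous
  have hsnd : ∀ ψ : Hilb d, Continuous fun T : OpPair d => T.snd ψ := fun ψ =>
    (ContinuousLinearMap.apply ℂ (Hilb d) ψ).continuous.comp sndCLM.continuous
  exact isClosed_iInter fun ψ => isClosed_iInter fun φ => isClosed_iInter fun _ =>
    isClosed_iInter fun n => isClosed_eq ((hev n).comp ((hfst φ).add (hsnd ψ)))
      (continuous_const.mul ((hev n).comp (hfst ψ)))

theorem entry_snd_of_mem_positionPairs {i : Fin d} {T : OpPair d} (hT : T ∈ positionPairs i)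
    (n m : Lat d) : entry T.snd n m = ((n i : ℂ) - m i) * entry T.fst n m := by
  have h := hT (delta m) ((m i : ℂ) • delta m) (fun n => ?_) n
  · rw [map_smul, lp.coeFn_add, Pi.add_apply, lp.coeFn_smul, Pi.smul_apply, smul_eq_mul] at h
    rw [entry, entry]
    linear_combination h
  · rw [lp.coeFn_smul, Pi.smul_apply, delta_apply, smul_eq_mul]
    split_ifs with h
    · rw [h]
    · simp

theorem inlHom_potential_mem_positionPairs (i : Fin d) (W : Lat d → ℝ)
    (hW : ∃ C : ℝ, ∀ n, |W n| ≤ C) : inlHom (potential W hW) ∈ positionPairs i := by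
  intro ψ φ h n
  change W n * φ n + 0 = n i * (W n * ψ n)
  rw [h n]
  ring

/-- The pair `(T, [Xᵢ, T])` for the translation `T` by `e`. -/
def translationPair (i : Fin d) (e : Lat d) : OpPair d :=
  mk (translation e) (-((e i : ℂ) • translation e))

theorem translationPair_mem_positionPairs (i : Fin d) (e : Lat d) :
    translationPair i e ∈ positionPairs i := by
  intro ψ φ h n
  change φ (n + e) + -((e i : ℂ) * ψ (n + e)) = n i * ψ (n + e)
  rw [h (n + e), Pi.add_apply]
  push_cast
  ring

/-- The pair `(Δ, [Xᵢ, Δ])`. -/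
def laplacianPair (i : Fin d) : OpPair d :=
  ∑ j : Fin d, (translationPair i (Pi.single j 1) + translationPair i (-Pi.single j 1))

theorem fst_laplacianPair (i : Fin d) : (laplacianPair i).fst = laplacian d := by
  rw [← fstHom_apply, laplacianPair, map_sum]
  rfl

theorem laplacianPair_mem_positionPairs (i : Fin d) : laplacianPair i ∈ positionPairs i :=
  Subalgebra.sum_mem _ fun _ _ => Subalgebra.add_mem _
    (translationPair_mem_positionPairs i _) (translationPair_mem_positionPairs i _)

theorem exp_smul_conj {A : Type*} [NormedRing A] [NormedAlgebra ℂ A] [CompleteSpace A] (u : Aˣ)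
    (D : A) (z : ℂ) :
    NormedSpace.exp (z • (↑u * D * ↑u⁻¹ : A)) = ↑u * NormedSpace.exp (z • D) * ↑u⁻¹ := by
  let : NormedAlgebra ℚ A := .restrictScalars ℚ ℂ _
  rw [← smul_mul_assoc, ← mul_smul_comm, NormedSpace.exp_units_conj]

/-- The exponential of a pair conjugate to `(D, D')` with `[D, D'] = 0`: up to bounded terms, the
commutator of `exp (z H)` with the position operator is `z exp (z H) (u D' u⁻¹)`. -/
theorem snd_exp_smul_conj (u : (OpPair d)ˣ) (D : OpPair d) (hD : Commute D.fst D.snd) (z : ℂ) :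
    (NormedSpace.exp (z • (↑u * D * ↑u⁻¹ : OpPair d))).snd
      = NormedSpace.exp (z • (↑u * D * ↑u⁻¹ : OpPair d).fst)
          * (z • (u.val.fst * D.snd * u⁻¹.val.fst) + u.val.fst * u⁻¹.val.snd)
        + u.val.snd * u⁻¹.val.fst * NormedSpace.exp (z • (↑u * D * ↑u⁻¹ : OpPair d).fst) := by
  have hu1 : u.val.fst * u⁻¹.val.fst = 1 := by rw [← fst_mul, Units.mul_inv, fst_one]
  have hu2 : u⁻¹.val.fst * u.val.fst = 1 := by rw [← fst_mul, Units.inv_mul, fst_one]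
  set w : (Op d)ˣ := ⟨u.val.fst, u⁻¹.val.fst, hu1, hu2⟩
  set E := NormedSpace.exp (z • D.fst) with hE
  have h1 : NormedSpace.exp (z • (↑u * D * ↑u⁻¹ : OpPair d).fst)
      = u.val.fst * E * u⁻¹.val.fst := by
    rw [fst_mul, fst_mul]
    exact exp_smul_conj w D.fst z
  have h2 : NormedSpace.exp (z • (↑u * D * ↑u⁻¹ : OpPair d))
      = ↑u * mk E (E * (z • D.snd)) * ↑u⁻¹ := by
    rw [exp_smul_conj, exp_of_commute]
    · rfl
    · exact (hD.smul_left z).smul_right z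
  rw [h2, h1]
  simp only [snd_mul, fst_mul, fst_mk, snd_mk]
  have h3 : ∀ X : Op d, u⁻¹.val.fst * (u.val.fst * X) = X := fun X => by
    rw [← mul_assoc, hu2, one_mul]
  simp only [mul_add, add_mul, mul_assoc, mul_smul_comm, smul_mul_assoc, h3]
  abel

end Pairs

/-! ### Ballistic motion -/

section Dynamics

variable {d : ℕ}

open OpPair

theorem exp_mem_positionPairs {i : Fin d} {T : OpPair d} (hT : T ∈ positionPairs i) :
    NormedSpace.exp T ∈ positionPairs i :=
  let : NormedAlgebra ℚ (OpPair d) := .restrictScalars ℚ ℂ _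
  NormedSpace.exp_mem (R := ℂ) (isClosed_positionPairs i) hT

/-- If `H` is conjugated to `D` by `u` and `[Xᵢ, D]` commutes with `D`, then `Xᵢ exp (-itH) ψ`
stays at bounded distance from `-it exp (-itH) u [Xᵢ, D] u⁻¹ ψ`, whose norm is
`t ‖u [Xᵢ, D] u⁻¹ ψ‖` because `exp (-itH)` is unitary. -/
theorem exists_position_evolution {i : Fin d} {u : (OpPair d)ˣ} {D : OpPair d}
    (hD : Commute D.fst D.snd) (hmem : (↑u * D * ↑u⁻¹ : OpPair d) ∈ positionPairs i)
    (hsa : IsSelfAdjoint (↑u * D * ↑u⁻¹ : OpPair d).fst) {ψ φ : Hilb d}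
    (hφ : ∀ n, φ n = (n i : ℂ) * ψ n) :
    ∃ (C : ℝ) (χ : ℝ → Hilb d), ∀ t : ℝ, 0 ≤ t →
      (∀ n, χ t n = (n i : ℂ) * evolution (↑u * D * ↑u⁻¹ : OpPair d).fst t ψ n) ∧
      |‖χ t‖ - t * ‖(u.val.fst * D.snd * u⁻¹.val.fst) ψ‖| ≤ C := by
  set H := (↑u * D * ↑u⁻¹ : OpPair d) with hH
  set G := u.val.fst * D.snd * u⁻¹.val.fst with hG
  set R := u.val.fst * u⁻¹.val.snd with hR
  set L := u.val.snd * u⁻¹.val.fst with hL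
  refine ⟨‖φ‖ + ‖R ψ‖ + ‖L‖ * ‖ψ‖, fun t => (NormedSpace.exp (-(Complex.I * (t : ℂ)) • H)).fst φ
    + (NormedSpace.exp (-(Complex.I * (t : ℂ)) • H)).snd ψ, fun t ht => ?_⟩
  beta_reduce
  set z : ℂ := -(Complex.I * t) with hz
  set E := evolution H.fst t with hE
  have hEiso : ∀ χ, ‖E χ‖ = ‖χ‖ := norm_evolution_apply hsa t
  have hmem' := exp_mem_positionPairs (Subalgebra.smul_mem _ hmem z)
  have hEz : NormedSpace.exp (z • H.fst) = E := rfl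
  have hfst : (NormedSpace.exp (z • H)).fst = E := by rw [fst_exp, fst_smul, hEz]
  have hsnd : (NormedSpace.exp (z • H)).snd = E * (z • G + R) + L * E := by
    rw [hH, snd_exp_smul_conj u D hD z, ← hH, hEz]
  have h := hmem' ψ φ hφ
  rw [hfst, hsnd] at h ⊢
  refine ⟨h, ?_⟩
  have hnorm : t * ‖G ψ‖ = ‖E (z • G ψ)‖ := by
    rw [hEiso, norm_smul, hz, norm_neg, norm_mul, Complex.norm_I, one_mul, Complex.norm_real,
      Real.norm_of_nonneg ht]
  rw [hnorm]
  refine (abs_norm_sub_norm_le _ _).trans ?_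
  have : E φ + (E * (z • G + R) + L * E) ψ - E (z • G ψ) = E φ + E (R ψ) + L (E ψ) := by
    change E φ + (E (z • G ψ + R ψ) + L (E ψ)) - E (z • G ψ) = _
    rw [map_add]
    abel
  rw [this]
  refine norm_add₃_le.trans ?_
  rw [hEiso, hEiso]
  gcongr
  exact (L.le_opNorm _).trans_eq (by rw [hEiso])

theorem tsum_enorm_sq_eq (ψ : Hilb d) : ∑' n, ‖ψ n‖ₑ ^ 2 = ENNReal.ofReal (‖ψ‖ ^ 2) := by
  have h := lp.norm_rpow_eq_tsum (p := 2) (by norm_num) ψ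
  have hs := (lp.memℓp ψ).summable (p := 2) (by norm_num)
  simp only [ENNReal.toReal_ofNat, Real.rpow_ofNat] at h hs
  rw [h, ENNReal.ofReal_tsum_of_nonneg (fun n => by positivity) hs]
  refine tsum_congr fun n => ?_
  rw [ENNReal.ofReal_pow (norm_nonneg _), ofReal_norm]

theorem positionNorm_eq {ψ : Hilb d} {χ : Fin d → Hilb d}
    (h : ∀ i n, χ i n = (n i : ℂ) * ψ n) :
    positionNorm ψ = ENNReal.ofReal √(∑ i, ‖χ i‖ ^ 2) := by
  have h1 : ∀ i, ∑' n : Lat d, ‖((n i : ℤ) : ℂ) * ψ n‖ₑ ^ 2 = ENNReal.ofReal (‖χ i‖ ^ 2) :=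
    fun i => by
      rw [← tsum_enorm_sq_eq]
      simp only [h]
  rw [positionNorm]
  simp only [h1]
  rw [← ENNReal.ofReal_sum_of_nonneg (fun _ _ => by positivity),
    ENNReal.ofReal_rpow_of_nonneg (by positivity) (by norm_num), Real.sqrt_eq_rpow]

/-- Ballistic motion with velocity operators `Gᵢ`. -/
theorem asympVelocityAt_eq {H : Op d} {ψ : Hilb d} {G : Fin d → Op d}
    (h : ∀ i, ∃ (C : ℝ) (χ : ℝ → Hilb d), ∀ t : ℝ, 0 ≤ t →
      (∀ n, χ t n = (n i : ℂ) * evolution H t ψ n) ∧ |‖χ t‖ - t * ‖G i ψ‖| ≤ C) :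
    asympVelocityAt H ψ = ENNReal.ofReal √(∑ i, ‖G i ψ‖ ^ 2) := by
  choose C χ h using h
  have hev : ∀ᶠ t : ℝ in atTop, positionNorm (evolution H t ψ) / ENNReal.ofReal t
      = ENNReal.ofReal √(∑ i, (‖χ i t‖ / t) ^ 2) := by
    filter_upwards [eventually_gt_atTop 0] with t ht
    rw [positionNorm_eq (χ := fun i => χ i t), ← ENNReal.ofReal_div_of_pos ht]
    · congr 1
      simp only [div_pow]
      rw [← Finset.sum_div, Real.sqrt_div' _ (by positivity), Real.sqrt_sq ht.le]
    · exact fun i => (h i t ht.le).1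
  have hlim : ∀ i, Tendsto (fun t => ‖χ i t‖ / t) atTop (nhds ‖G i ψ‖) := by
    intro i
    rw [tendsto_iff_norm_sub_tendsto_zero]
    refine squeeze_zero' (Eventually.of_forall fun _ => norm_nonneg _) ?_
      (tendsto_const_nhds.div_atTop tendsto_id : Tendsto (fun t : ℝ => C i / t) atTop (nhds 0))
    filter_upwards [eventually_gt_atTop 0] with t ht
    have h2 : ‖χ i t‖ / t - ‖G i ψ‖ = (‖χ i t‖ - t * ‖G i ψ‖) / t := by
      field_simp
    rw [h2, norm_div, Real.norm_of_nonneg ht.le, Real.norm_eq_abs]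
    gcongr
    exact (h i t ht.le).2
  rw [asympVelocityAt]
  refine Tendsto.limsup_eq (Tendsto.congr' (hev.mono fun _ h => h.symm) ?_)
  exact ENNReal.tendsto_ofReal (Real.continuous_sqrt.continuousAt.tendsto.comp
    (tendsto_finsetSum _ fun i _ => (hlim i).pow 2))

end Dynamics

/-! ### The velocity operators for large coupling -/

section Velocity

variable {d : ℕ} {G : Type*} [AddCommGroup G] {κ : Lat d →+ G}

open OpPair

theorem laplacianPair_mem (i : Fin d) :
    laplacianPair i ∈ positionPairs i ⊓ (periodicOps κ).comap fstHom := by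
  refine ⟨laplacianPair_mem_positionPairs i, ?_⟩
  change (laplacianPair i).fst ∈ periodicOps κ
  rw [fst_laplacianPair]
  exact laplacian_mem_periodicOps

variable [DecidableEq G]

theorem commute_fst_snd {i : Fin d} {X : OpPair d} (hX : X ∈ positionPairs i)
    (hper : X.fst ∈ periodicOps κ) (hdiag : ∀ a, Commute (cosetProj κ a) X.fst) :
    Commute X.fst X.snd := by
  refine commute_of_entry_periodic κ (fun n m h => entry_eq_zero_of_commute κ hdiag h)
    (fun n m h => ?_) (fun x hx n m => entry_add_add_of_mem_periodicOps hper hx n m)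
    (fun x hx n m => ?_)
  · rw [entry_snd_of_mem_positionPairs hX, entry_eq_zero_of_commute κ hdiag h, mul_zero]
  · rw [entry_snd_of_mem_positionPairs hX, entry_snd_of_mem_positionPairs hX,
      entry_add_add_of_mem_periodicOps hper hx]
    simp

theorem norm_units_inv_le {A : Type*} [NormedRing A] [NormOneClass A] (u : Aˣ)
    (hu : ‖(u : A) - 1‖ ≤ 1 / 2) : ‖(↑u⁻¹ : A)‖ ≤ 2 := by
  have h : (↑u⁻¹ : A) = 1 - ↑u⁻¹ * (u - 1) := by rw [mul_sub, Units.inv_mul]; simp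
  have h1 : ‖(↑u⁻¹ : A)‖ ≤ 1 + ‖(↑u⁻¹ : A)‖ * (1 / 2) := by
    calc ‖(↑u⁻¹ : A)‖ = ‖1 - ↑u⁻¹ * ((u : A) - 1)‖ := by rw [← h]
      _ ≤ ‖(1 : A)‖ + ‖(↑u⁻¹ : A)‖ * ‖(u : A) - 1‖ :=
        (norm_sub_le _ _).trans (add_le_add_right (norm_mul_le _ _) _)
      _ ≤ _ := by
        rw [norm_one]
        gcongr
  linarith

theorem norm_mul_mul_sub_le {A : Type*} [NormedRing A] {u w x : A} (huw : u * w = 1)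
    (hw : ‖w‖ ≤ 2) : ‖u * x * w - x‖ ≤ 4 * ‖u - 1‖ * ‖x‖ := by
  have h : u * x * w - x = ((u - 1) * x - x * (u - 1)) * w := by
    have : x = x * u * w := by rw [mul_assoc, huw, mul_one]
    calc u * x * w - x = u * x * w - x * u * w := by rw [← this]
      _ = _ := by noncomm_ring
  rw [h]
  calc ‖((u - 1) * x - x * (u - 1)) * w‖
      ≤ (‖u - 1‖ * ‖x‖ + ‖x‖ * ‖u - 1‖) * ‖w‖ := (norm_mul_le _ _).trans (by
        gcongr
        exact (norm_sub_le _ _).trans (add_le_add (norm_mul_le _ _) (norm_mul_le _ _)))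
    _ ≤ (‖u - 1‖ * ‖x‖ + ‖x‖ * ‖u - 1‖) * 2 := by gcongr
    _ = _ := by ring

/-- Conjugation by `u = 1 + O(η)` does not affect the leading term of `x = c b + O(η^(q+1))`. -/
theorem norm_conj_sub_smul_le {A : Type*} [NormedRing A] [NormedSpace ℂ A] {u w x b : A}
    (huw : u * w = 1) (hw : ‖w‖ ≤ 2) {c : ℂ} {η L N : ℝ} {q : ℕ} (hη : 0 ≤ η) (hη1 : η ≤ 1)
    (hL : 0 ≤ L) (hN : 0 ≤ N) (hu : ‖u - 1‖ ≤ L * η) (hc : ‖c‖ = η ^ q)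
    (hx : ‖x - c • b‖ ≤ N * η ^ (q + 1)) :
    ‖u * x * w - c • b‖ ≤ (4 * L * (‖b‖ + N) + N) * η ^ (q + 1) := by
  have hxn : ‖x‖ ≤ (‖b‖ + N) * η ^ q := by
    calc ‖x‖ ≤ ‖c • b‖ + ‖x - c • b‖ := norm_le_norm_add_norm_sub' _ _
      _ ≤ η ^ q * ‖b‖ + N * (η ^ q * 1) := by
          rw [norm_smul, hc]
          gcongr
          refine hx.trans ?_
          rw [pow_succ η]
          gcongr
      _ = _ := by ring
  calc ‖u * x * w - c • b‖ ≤ ‖u * x * w - x‖ + ‖x - c • b‖ :=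
        norm_sub_le_norm_sub_add_norm_sub _ _ _
    _ ≤ 4 * (L * η) * ((‖b‖ + N) * η ^ q) + N * η ^ (q + 1) := by
        gcongr
        refine (norm_mul_mul_sub_le huw hw).trans ?_
        gcongr
    _ = _ := by ring

theorem inlHom_cosetProj_mem (i : Fin d) (a : G) :
    inlHom (cosetProj κ a) ∈ positionPairs i ⊓ (periodicOps κ).comap fstHom :=
  ⟨inlHom_potential_mem_positionPairs i _ _, cosetProj_mem_periodicOps a⟩

variable [Fintype G]

variable (κ) in
/-- The coefficient of `εᵏ` in the block-diagonal form of `V + ε Δ`, paired with its commutator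
with `Xᵢ`. -/
abbrev diagPair (v : G → ℝ) (i : Fin d) (k : ℕ) : OpPair d :=
  diagCoeff (fun a => inlHom (cosetProj κ a)) (fun a => (v a : ℂ)) (laplacianPair i) k

variable {v : G → ℝ} {q : ℕ}

theorem diagPair_mem (i : Fin d) (k : ℕ) :
    diagPair κ v i k ∈ positionPairs i ⊓ (periodicOps κ).comap fstHom :=
  diagCoeff_mem (inlHom_cosetProj_mem i) (laplacianPair_mem i) k

theorem fst_diagPair (i : Fin d) (k : ℕ) : (diagPair κ v i k).fst
    = diagCoeff (cosetProj κ) (fun a => (v a : ℂ)) (laplacian d) k := by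
  rw [← fstHom_apply, map_diagCoeff, fstHom_apply, fst_laplacianPair]
  rfl

theorem entry_snd_diagPair (i : Fin d) (k : ℕ) (n m : Lat d) :
    entry (diagPair κ v i k).snd n m = ((n i : ℂ) - m i)
      * entry (diagCoeff (cosetProj κ) (fun a => (v a : ℂ)) (laplacian d) k) n m := by
  rw [entry_snd_of_mem_positionPairs (diagPair_mem i k).1, fst_diagPair]

theorem snd_diagPair_eq_zero (hq : ∀ n m, κ n = κ m → latDist n m < q + 1 → n = m) (i : Fin d)
    {k : ℕ} (hk : k < q) : (diagPair κ v i k).snd = 0 := by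
  refine ext_entry fun n m => ?_
  rw [entry_snd_diagPair, entry_zero]
  rcases eq_or_ne n m with rfl | h
  · rw [sub_self, zero_mul]
  · rw [entry_diagCoeff_eq_zero hq hk h, mul_zero]

theorem snd_diagPair_delta_ne_zero (hv : Function.Injective v)
    (hq : ∀ n m, κ n = κ m → latDist n m < q + 1 → n = m) {i : Fin d}
    (hi : κ (Pi.single i (-((q + 1 : ℕ) : ℤ))) = 0) :
    (diagPair κ v i q).snd (delta 0) ≠ 0 := by
  intro h
  have h1 : entry (diagPair κ v i q).snd (Pi.single i (-((q + 1 : ℕ) : ℤ))) 0 = 0 := by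
    rw [entry, h]
    rfl
  rw [entry_snd_diagPair] at h1
  refine mul_ne_zero ?_ (entry_diagCoeff_single_ne_zero
    (Complex.ofReal_injective.comp hv) hq hi) h1
  rw [Pi.single_eq_same, Pi.zero_apply, Int.cast_zero, sub_zero, Int.cast_ne_zero]
  omega

theorem sum_smul_cosetProj {V : Lat d → ℝ} (hV : ∃ C : ℝ, ∀ n, |V n| ≤ C)
    (hVv : ∀ n, V n = v (κ n)) :
    ∑ a, (v a : ℂ) • cosetProj κ a = potential V hV := by
  refine ext_entry fun n m => ?_
  simp only [entry_sum, entry_smul, entry_cosetProj, entry_potential, hVv]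
  simp

/-- For large `μ` the motion generated by `Δ + μ V` in the direction `i` is ballistic, with a
velocity operator `μ^(-q) B + O(μ^(-q-1))`, where distinct points with the same value of `V` have
`ℓ¹` distance at least `q + 1`. -/
theorem exists_velocity_operator {V : Lat d → ℝ} (hV : ∃ C : ℝ, ∀ n, |V n| ≤ C)
    (hVv : ∀ n, V n = v (κ n)) (hv : Function.Injective v)
    (hq : ∀ n m, κ n = κ m → latDist n m < q + 1 → n = m) (i : Fin d) :
    ∃ B : Op d, (κ (Pi.single i (-((q + 1 : ℕ) : ℤ))) = 0 → B (delta 0) ≠ 0) ∧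
      ∃ K μ₀ : ℝ, ∀ μ : ℝ, μ₀ ≤ μ → ∃ Y : Op d,
        ‖Y - (((μ⁻¹ ^ q : ℝ) : ℂ)) • B‖ ≤ K * μ⁻¹ ^ (q + 1) ∧
        ∀ ψ φ : Hilb d, (∀ n, φ n = (n i : ℂ) * ψ n) →
          ∃ (C : ℝ) (χ : ℝ → Hilb d), ∀ t : ℝ, 0 ≤ t →
            (∀ n, χ t n = (n i : ℂ) * evolution (hamiltonian V hV μ) t ψ n) ∧
            |‖χ t‖ - t * ‖Y ψ‖| ≤ C := by
  set P : G → OpPair d := fun a => inlHom (cosetProj κ a) with hP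
  set w : G → ℂ := fun a => (v a : ℂ) with hw
  set Δ := laplacianPair i with hΔ
  have hPc : CompleteOrthogonalIdempotents P :=
    (completeOrthogonalIdempotents_cosetProj κ).map (inlHom : Op d →ₐ[ℂ] OpPair d).toRingHom
  have hwi : Function.Injective w := Complex.ofReal_injective.comp hv
  obtain ⟨M, hM1, hM⟩ := exists_norm_conjCoeff_le P w Δ
  have hM0 : 0 ≤ M := by linarith
  set B := (diagPair κ v i q).snd with hB
  refine ⟨B, fun hi => snd_diagPair_delta_ne_zero hv hq hi,
    4 * (2 * M) * (‖B‖ + 2 * M * M ^ (q + 1)) + 2 * M * M ^ (q + 1), 4 * M, fun μ hμ => ?_⟩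
  have hμ0 : 0 < μ := by linarith
  set ε : ℂ := ((μ⁻¹ : ℝ) : ℂ) with hε
  have hεn : ‖ε‖ = μ⁻¹ := by
    rw [hε, Complex.norm_real, Real.norm_of_nonneg (by positivity)]
  have hεM : ‖ε‖ * M ≤ 1 / 4 := by
    rw [hεn, inv_mul_le_iff₀ hμ0]
    linarith
  have hμ1 : μ⁻¹ ≤ 1 := inv_le_one_of_one_le₀ (by linarith)
  have hbU : ∀ k, ‖conjCoeff P w Δ k‖ ≤ 1 * M ^ k := fun k => by
    rw [one_mul]
    exact (hM k).1
  have hbD : ∀ k, ‖diagCoeff P w Δ k‖ ≤ M * M ^ k := fun k => (hM k).2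
  have hsU := summable_norm_pow_smul hM0 hbU (ε := ε) (by linarith)
  have hsD := summable_norm_pow_smul hM0 hbD (ε := ε) (by linarith)
  have hconj := conj_eq_of_summable hPc hwi Δ hsU hsD
  have hU1 := norm_tsum_pow_smul_sub_le hM0 hbU (q := 0) (by simp) (ε := ε) (by linarith)
  rw [pow_zero, conjCoeff_zero, one_smul, zero_add, pow_one, pow_one, mul_one, hεn] at hU1
  set U := ∑' k, ε ^ k • conjCoeff P w Δ k with hU
  set D := ∑' k, ε ^ k • diagCoeff P w Δ k with hD
  have hU2 : ‖U - 1‖ ≤ 1 / 2 := by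
    rw [hεn] at hεM
    linarith
  obtain ⟨u, hu⟩ : IsUnit U := by
    rw [← sub_sub_cancel 1 U]
    refine isUnit_one_sub_of_norm_lt_one ?_
    rw [norm_sub_rev]
    linarith
  rw [← hu] at hconj hU1 hU2
  -- The pair `X` generates the conjugated dynamics up to the factor `μ = ε⁻¹`.
  set X := ∑ a, w a • P a + ε • D with hX
  have hXmem : X ∈ positionPairs i ⊓ (periodicOps κ).comap fstHom := by
    have hcl : IsClosed ((positionPairs i ⊓ (periodicOps κ).comap fstHom :
        Subalgebra ℂ (OpPair d)) : Set (OpPair d)) :=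
      (isClosed_positionPairs i).inter ((isClosed_periodicOps κ).preimage fstCLM.continuous)
    refine Subalgebra.add_mem _ (Subalgebra.sum_mem _ fun a _ =>
      Subalgebra.smul_mem _ (inlHom_cosetProj_mem i a) _) (Subalgebra.smul_mem _ ?_ _)
    exact tsum_mem hcl fun k => Subalgebra.smul_mem _ (diagPair_mem i k) _
  have hXcomm : ∀ a, Commute (P a) X := fun a => by
    refine Commute.add_right ?_ (Commute.smul_right (Commute.tsum_right _ fun k =>
      (commute_blockDiag hPc.toOrthogonalIdempotents a _).smul_right _) _)
    rw [Commute, SemiconjBy, mul_sum_smul hPc.toOrthogonalIdempotents,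
      sum_smul_mul hPc.toOrthogonalIdempotents]
  have hXfs : Commute X.fst X.snd := commute_fst_snd hXmem.1 hXmem.2 fun a =>
    (hXcomm a).map fstHom
  have hμε : (μ : ℂ) * ε = 1 := by
    rw [hε, ← Complex.ofReal_mul, mul_inv_cancel₀ hμ0.ne', Complex.ofReal_one]
  have hsndX : ((μ : ℂ) • X).snd = D.snd := by
    have h0 : (∑ a, w a • P a).snd = 0 := by
      rw [← sndCLM_apply, map_sum]
      exact Finset.sum_eq_zero fun a _ => by simp [hP]
    rw [snd_smul, hX, snd_add, h0, zero_add, snd_smul, smul_smul, hμε, one_smul]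
  have hHpair : (↑u * ((μ : ℂ) • X) * ↑u⁻¹ : OpPair d)
      = (μ : ℂ) • ∑ a, w a • P a + Δ := by
    rw [mul_smul_comm, ← hconj, smul_mul_assoc, mul_assoc, Units.mul_inv, mul_one, smul_add,
      smul_smul, hμε, one_smul]
  have hHfst : (↑u * ((μ : ℂ) • X) * ↑u⁻¹ : OpPair d).fst = hamiltonian V hV μ := by
    rw [hHpair, fst_add, fst_smul, ← fstHom_apply (∑ a, w a • P a), map_sum, hΔ,
      fst_laplacianPair, hamiltonian, ← sum_smul_cosetProj hV hVv, add_comm]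
    rfl
  have hHmem : (↑u * ((μ : ℂ) • X) * ↑u⁻¹ : OpPair d) ∈ positionPairs i := by
    rw [hHpair]
    exact Subalgebra.add_mem _ (Subalgebra.smul_mem _ (Subalgebra.sum_mem _ fun a _ =>
      Subalgebra.smul_mem _ (inlHom_cosetProj_mem i a).1 _) _) (laplacianPair_mem_positionPairs i)
  refine ⟨u.val.fst * D.snd * u⁻¹.val.fst, ?_, fun ψ φ hφ => ?_⟩
  · -- The first `q` coefficients of `[Xᵢ, D]` vanish, and `u = 1 + O(ε)`.
    have hDsnd : D.snd = ∑' k, ε ^ k • (diagPair κ v i k).snd := by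
      rw [← sndCLM_apply, hD, sndCLM.map_tsum hsD.of_norm]
      simp
      rfl
    have hDB : ‖D.snd - ε ^ q • B‖ ≤ 2 * M * M ^ (q + 1) * ‖ε‖ ^ (q + 1) := by
      rw [hDsnd]
      exact norm_tsum_pow_smul_sub_le hM0 (fun k => (norm_snd_le _).trans (hbD k))
        (fun k hk => snd_diagPair_eq_zero hq i hk) (by linarith)
    have hu1 : ‖u.val.fst - 1‖ ≤ 2 * M * μ⁻¹ := by
      rw [← fst_one, ← fst_sub]
      exact (OpPair.norm_fst_le _).trans hU1
    have hu2 : ‖u⁻¹.val.fst‖ ≤ 2 := (OpPair.norm_fst_le _).trans (norm_units_inv_le u hU2)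
    have hu3 : u.val.fst * u⁻¹.val.fst = 1 := by rw [← fst_mul, Units.mul_inv, fst_one]
    rw [hεn] at hDB
    rw [Complex.ofReal_pow]
    exact norm_conj_sub_smul_le hu3 hu2 (by positivity) hμ1 (by positivity) (by positivity) hu1
      (by rw [norm_pow, hεn]) hDB
  · have h := exists_position_evolution (u := u) (D := (μ : ℂ) • X)
      ((hXfs.smul_left _).smul_right _) hHmem
      (by rw [hHfst]; exact isSelfAdjoint_hamiltonian V hV μ) hφ
    rwa [hHfst, hsndX] at h

end Velocity

/-! ### Suprema and asymptotics -/

section Asymptotics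

theorem sqrt_sum_sq_le_sum {ι : Type*} (s : Finset ι) {x : ι → ℝ} (hx : ∀ i, 0 ≤ x i) :
    √(∑ i ∈ s, x i ^ 2) ≤ ∑ i ∈ s, x i := by
  refine Real.sqrt_le_iff.2 ⟨Finset.sum_nonneg fun i _ => hx i, ?_⟩
  exact Finset.sum_sq_le_sq_sum_of_nonneg fun i _ => hx i

theorem abs_sqrt_sum_sub_le {ι E : Type*} [Fintype ι] [NormedAddCommGroup E] [NormedSpace ℂ E]
    (a b : ι → E) {c : ℝ} (hc : 0 ≤ c) :
    |√(∑ i, ‖a i‖ ^ 2) - c * √(∑ i, ‖b i‖ ^ 2)| ≤ ∑ i, ‖a i - (c : ℂ) • b i‖ := by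
  have h := abs_norm_sub_norm_le (WithLp.toLp 2 a) ((c : ℂ) • WithLp.toLp 2 b)
  rw [norm_smul, Complex.norm_real, Real.norm_of_nonneg hc, PiLp.norm_eq_of_L2,
    PiLp.norm_eq_of_L2, PiLp.norm_eq_of_L2] at h
  exact h.trans (sqrt_sum_sq_le_sum _ fun i => norm_nonneg _)

/-- Suprema inherit uniform estimates. -/
theorem iSup_ofReal_approx {α : Type*} {S : Set α} (hS : S.Nonempty) {f g : α → ℝ}
    (hf : ∀ x ∈ S, 0 ≤ f x) (hg : BddAbove (g '' S)) {a e : ℝ} (ha : 0 < a)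
    (h : ∀ x ∈ S, |f x - a * g x| ≤ e) :
    (⨆ x ∈ S, ENNReal.ofReal (f x)) ≠ ∞ ∧
      |(⨆ x ∈ S, ENNReal.ofReal (f x)).toReal - a * sSup (g '' S)| ≤ e := by
  set T := ⨆ x ∈ S, ENNReal.ofReal (f x)
  have hle : T ≤ ENNReal.ofReal (a * sSup (g '' S) + e) := by
    refine iSup₂_le fun x hx => ENNReal.ofReal_le_ofReal ?_
    have h1 := (abs_le.1 (h x hx)).2
    have h2 := mul_le_mul_of_nonneg_left (le_csSup hg (Set.mem_image_of_mem g hx)) ha.le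
    linarith
  have hT : T ≠ ∞ := (hle.trans_lt ENNReal.ofReal_lt_top).ne
  have hfT : ∀ x ∈ S, f x ≤ T.toReal := fun x hx => by
    rw [← ENNReal.ofReal_le_iff_le_toReal hT]
    exact le_iSup₂ (f := fun x (_ : x ∈ S) => ENNReal.ofReal (f x)) x hx
  have hsup : sSup (g '' S) ≤ (T.toReal + e) / a := by
    refine csSup_le (hS.image g) ?_
    rintro _ ⟨x, hx, rfl⟩
    rw [le_div_iff₀ ha]
    have h1 := (abs_le.1 (h x hx)).1
    have h2 := hfT x hx
    linarith
  rw [le_div_iff₀ ha] at hsup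
  have hpos : 0 ≤ a * sSup (g '' S) + e := by
    obtain ⟨x, hx⟩ := hS
    have h1 := (abs_le.1 (h x hx)).2
    have h2 := mul_le_mul_of_nonneg_left (le_csSup hg (Set.mem_image_of_mem g hx)) ha.le
    have h3 := hf x hx
    linarith
  refine ⟨hT, abs_le.2 ⟨by linarith, ?_⟩⟩
  have := ENNReal.toReal_le_of_le_ofReal hpos hle
  linarith

theorem hasVelocityAsymptotics_of_le {w : ℝ → ℝ≥0∞} {C K μ₀ : ℝ} {q : ℕ}
    (h : ∀ μ ≥ μ₀, 0 < μ → w μ ≠ ∞ ∧ |(w μ).toReal - μ⁻¹ ^ q * C| ≤ K * μ⁻¹ ^ (q + 1)) :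
    HasVelocityAsymptotics w C (q + 1) := by
  refine ⟨?_, IsBigO.of_bound K ?_⟩
  · filter_upwards [eventually_ge_atTop μ₀, eventually_gt_atTop 0] with μ h1 h2
    exact (h μ h1 h2).1
  · filter_upwards [eventually_ge_atTop μ₀, eventually_gt_atTop 0] with μ h1 h2
    have h3 : μ ^ (-((q + 1 : ℕ) : ℤ)) = μ⁻¹ ^ (q + 1) := by
      rw [zpow_neg, zpow_natCast, inv_pow]
    have h4 : μ ^ (-((q + 1 : ℕ) : ℤ) + 1) = μ⁻¹ ^ q := by
      rw [show -((q + 1 : ℕ) : ℤ) + 1 = -(q : ℤ) by push_cast; ring, zpow_neg, zpow_natCast,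
        inv_pow]
    rw [h3, h4, mul_comm C, Real.norm_eq_abs, Real.norm_of_nonneg (by positivity)]
    exact (h μ h1 h2).2

end Asymptotics

/-! ### The colouring by residues -/

section Residues

variable {d : ℕ}

/-- Reduction modulo the period lattice. -/
def residue (p : Fin d → ℕ) : Lat d →+ ((i : Fin d) → ZMod (p i)) where
  toFun n i := (n i : ZMod (p i))
  map_zero' := by ext; simp
  map_add' n m := by ext; simp

theorem residue_eq_iff {p : Fin d → ℕ} {n m : Lat d} :
    residue p n = residue p m ↔ ∀ i, (p i : ℤ) ∣ n i - m i := by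
  rw [funext_iff]
  refine forall_congr' fun i => ?_
  rw [eq_comm]
  exact ZMod.intCast_eq_intCast_iff_dvd_sub (m i) (n i) (p i)

/-- The canonical representative of a residue class in the fundamental cell. -/
def representative {p : Fin d → ℕ} (a : (i : Fin d) → ZMod (p i)) : Lat d := fun i => (a i).val

theorem representative_mem_cell {p : Fin d → ℕ} [∀ i, NeZero (p i)]
    (a : (i : Fin d) → ZMod (p i)) : representative a ∈ cell p := fun i =>
  ⟨Int.natCast_nonneg _, Int.ofNat_lt.2 (a i).val_lt⟩

theorem representative_injective {p : Fin d → ℕ} [∀ i, NeZero (p i)] :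
    Function.Injective (representative (p := p)) := fun a b h => by
  funext i
  exact ZMod.val_injective _ (Int.ofNat_inj.1 (congrFun h i))

theorem IsPeriodic.apply_representative {p : Fin d → ℕ} [∀ i, NeZero (p i)] {V : Lat d → ℝ}
    (hV : IsPeriodic p V) (n : Lat d) : V n = V (representative (residue p n)) := by
  rw [← hV (representative (residue p n)) fun i => n i / (p i : ℤ)]
  congr 1
  funext i
  have : ((n i : ZMod (p i)).val : ℤ) = n i % (p i : ℤ) := ZMod.val_intCast _
  simp only [Pi.add_apply, representative]
  change n i = ((n i : ZMod (p i)).val : ℤ) + _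
  rw [this, mul_comm, Int.emod_add_mul_ediv]

theorem eq_of_residue_eq_of_latDist_lt {p : Fin d → ℕ} {q : ℕ} (hp : ∀ i, q ≤ p i) {n m : Lat d}
    (h : residue p n = residue p m) (hd : latDist n m < q) : n = m := by
  funext i
  have h1 : (n i - m i).natAbs ≤ latDist n m :=
    Finset.single_le_sum (f := fun i => (n i - m i).natAbs) (fun _ _ => Nat.zero_le _)
      (Finset.mem_univ i)
  have h2 := hp i
  have h3 := Int.eq_zero_of_abs_lt_dvd (residue_eq_iff.1 h i) (by rw [Int.abs_eq_natAbs]; omega)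
  omega

end Residues

theorem delta_mem_positionDomain {d : ℕ} (m : Lat d) : delta m ∈ positionDomain d := by
  intro i
  refine memℓp_gen (summable_of_ne_finset_zero (s := {m}) fun n hn => ?_)
  rw [delta_apply, if_neg (by simpa using hn)]
  simp

end PeriodicSchrodinger

end

open PeriodicSchrodinger in
theorem theorem1 {d : ℕ} (p : Fin d → ℕ) (hp : ∀ i, 0 < p i) (p₀ : ℕ)
    (hp₀ : IsLeast (Set.range p) p₀) (V : PeriodicSchrodinger.Lat d → ℝ)
    (hV : PeriodicSchrodinger.IsPeriodic p V)
    (hnd : PeriodicSchrodinger.IsNondegenerate p V) :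
    (∃ C : ℝ, 0 < C ∧
      PeriodicSchrodinger.HasVelocityAsymptotics
        (fun μ => PeriodicSchrodinger.asympVelocity
          (PeriodicSchrodinger.hamiltonian V (hV.exists_bound hp) μ)) C p₀) ∧
    (∃ c : ℝ, 0 < c ∧
      PeriodicSchrodinger.HasVelocityAsymptotics
        (fun μ => PeriodicSchrodinger.asympVelocityAt
          (PeriodicSchrodinger.hamiltonian V (hV.exists_bound hp) μ)
          (PeriodicSchrodinger.deltaZero d)) c p₀) := by
  have : ∀ i, NeZero (p i) := fun i => ⟨(hp i).ne'⟩
  obtain ⟨⟨i₀, hi₀⟩, hleast⟩ := hp₀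
  have hple : ∀ i, p₀ ≤ p i := fun i => hleast ⟨i, rfl⟩
  obtain ⟨q, rfl⟩ : ∃ q, p₀ = q + 1 := ⟨p₀ - 1, by have := hp i₀; omega⟩
  have hv : Function.Injective fun a : (i : Fin d) → ZMod (p i) => V (representative a) :=
    fun a b h => representative_injective
      (hnd (representative_mem_cell a) (representative_mem_cell b) h)
  have hbnd := hV.exists_bound hp
  choose B hB K μ₀ hBμ using fun i => exists_velocity_operator (κ := residue p) (q := q) hbnd
    hV.apply_representative hv (fun n m h => eq_of_residue_eq_of_latDist_lt hple h) i
  set S : Set (Hilb d) := {ψ | ψ ∈ positionDomain d ∧ ‖ψ‖ = 1} with hS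
  set g : Hilb d → ℝ := fun ψ => √(∑ i, ‖B i ψ‖ ^ 2) with hg
  -- The velocity of a normalized state in the domain, up to a uniform error.
  have key : ∀ μ : ℝ, ∑ i, |μ₀ i| ≤ μ → 0 < μ → ∃ f : Hilb d → ℝ, (∀ ψ, 0 ≤ f ψ) ∧
      ∀ ψ ∈ S, asympVelocityAt (hamiltonian V hbnd μ) ψ = ENNReal.ofReal (f ψ) ∧
        |f ψ - μ⁻¹ ^ q * g ψ| ≤ (∑ i, K i) * μ⁻¹ ^ (q + 1) := by
    intro μ hμ hμ0
    have hμi : ∀ i, μ₀ i ≤ μ := fun i => (le_abs_self _).trans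
      ((Finset.single_le_sum (f := fun i => |μ₀ i|) (fun _ _ => abs_nonneg _)
        (Finset.mem_univ i)).trans hμ)
    choose Y hYB hY using fun i => hBμ i μ (hμi i)
    refine ⟨fun ψ => √(∑ i, ‖Y i ψ‖ ^ 2), fun ψ => Real.sqrt_nonneg _, fun ψ hψ => ⟨?_, ?_⟩⟩
    · exact asympVelocityAt_eq fun i => hY i ψ ⟨_, hψ.1 i⟩ fun n => rfl
    · refine (abs_sqrt_sum_sub_le _ _ (by positivity)).trans ?_
      rw [Finset.sum_mul]
      refine Finset.sum_le_sum fun i _ => ?_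
      calc ‖Y i ψ - ((μ⁻¹ ^ q : ℝ) : ℂ) • B i ψ‖
          = ‖(Y i - ((μ⁻¹ ^ q : ℝ) : ℂ) • B i) ψ‖ := rfl
        _ ≤ ‖Y i - ((μ⁻¹ ^ q : ℝ) : ℂ) • B i‖ * ‖ψ‖ := ContinuousLinearMap.le_opNorm _ _
        _ ≤ _ := by
          rw [hψ.2, mul_one]
          exact hYB i
  have hδ : deltaZero d ∈ S := by
    refine ⟨delta_mem_positionDomain 0, ?_⟩
    rw [deltaZero, lp.norm_single (by norm_num), norm_one]
  have hgδ : 0 < g (deltaZero d) := by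
    refine Real.sqrt_pos.2 (Finset.sum_pos' (fun i _ => by positivity)
      ⟨i₀, Finset.mem_univ _, ?_⟩)
    have hres : residue p (Pi.single i₀ (-((q + 1 : ℕ) : ℤ))) = 0 := by
      rw [← map_zero (residue p), residue_eq_iff]
      intro j
      rcases eq_or_ne j i₀ with rfl | hj
      · rw [Pi.single_eq_same, hi₀, Pi.zero_apply, sub_zero, dvd_neg]
      · rw [Pi.single_eq_of_ne hj]
        simp
    have := norm_pos_iff.2 (hB i₀ hres)
    positivity
  have hgb : BddAbove (g '' S) := by
    refine ⟨∑ i, ‖B i‖, ?_⟩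
    rintro _ ⟨ψ, hψ, rfl⟩
    refine (sqrt_sum_sq_le_sum _ fun i => norm_nonneg _).trans (Finset.sum_le_sum fun i _ => ?_)
    simpa [hψ.2] using (B i).le_opNorm ψ
  refine ⟨⟨sSup (g '' S), hgδ.trans_le (le_csSup hgb ⟨_, hδ, rfl⟩),
    hasVelocityAsymptotics_of_le (K := ∑ i, K i) (μ₀ := ∑ i, |μ₀ i|) fun μ hμ hμ0 => ?_⟩,
    ⟨g (deltaZero d), hgδ,
    hasVelocityAsymptotics_of_le (K := ∑ i, K i) (μ₀ := ∑ i, |μ₀ i|) fun μ hμ hμ0 => ?_⟩⟩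
  · obtain ⟨f, hf0, hf⟩ := key μ hμ hμ0
    have h1 : asympVelocity (hamiltonian V hbnd μ) = ⨆ ψ ∈ S, ENNReal.ofReal (f ψ) :=
      iSup_congr fun ψ => iSup_congr fun hψ => (hf ψ hψ).1
    rw [h1]
    exact iSup_ofReal_approx ⟨_, hδ⟩ (fun ψ _ => hf0 ψ) hgb (by positivity)
      fun ψ hψ => (hf ψ hψ).2
  · obtain ⟨f, hf0, hf⟩ := key μ hμ hμ0
    rw [(hf _ hδ).1, ENNReal.toReal_ofReal (hf0 _)]
    exact ⟨ENNReal.ofReal_ne_top, (hf _ hδ).2⟩
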